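/- Let $\mathbb{F}_q$ be a finite field, let $m\ge 2$ be an integer with $q\equiv 1 \pmod m$, let $r$ be an integer with $\gcd(m,r)=1$, and let $b_1,b_2\in\mathbb{F}_q[T]$ be coprime polynomials with $\deg b_1=m$ and $\deg b_2=m-r$. Let $\mathcal F=(F_0,F_1,\ldots)$ be a sequence of fields defined recursively by the equation $y^m=b_1(x)/b_2(x)$, that is: $F_0=\mathbb{F}_q(x_0)$ with $x_0$ transcendental over $\mathbb{F}_q$, and for all $i\ge 0$, $F_{i+1}=F_i(x_{i+1})$ with $$x_{i+1}^m=\frac{b_1(x_i)}{b_2(x_i)}.$$ Then $\mathcal F$ is admissible: each $F_i$ is a function field over $\mathbb{F}_q$ (a finite extension of a rational function field), $F_i\subsetneq F_{i+1}$ and $F_{i+1}/F_i$ is finite and separable for all $i\ge 0$, and $\mathbb{F}_q$ is algebraically closed in every $F_i$. Moreover $\mathcal F$ is tame: for every $n$, every place $P$ of $F_0$ and every place $Q$ of $F_n$ lying over $P$, the ramification index $e(Q|P)$ is relatively prime to the characteristic of $\mathbb{F}_q$. Let $\overline{\mathbb{F}}_q$ be an algebraic closure of $\mathbb{F}_q$,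 and for a polynomial $g$ let $Z_g$ be its set of zeros in $\overline{\mathbb{F}}_q$. Assume that there is a finite set $S_0\subset\overline{\mathbb{F}}_q$ such that 1. $Z_{b_1}\subset S_0$; 2. $Z_{b_2}\subset S_0$; 3. $Z_{\sigma_\gamma}\subset S_0$ for all $\gamma\in S_0$, where $\sigma_\gamma(T)=b_2(T)\gamma^m-b_1(T)$. Then the ramification locus of $\mathcal F$ over $F_0$, that is, the set of places $P$ of $F_0$ for which there are $n\ge 0$ and a place $Q$ of $F_n$ over $P$ with $e(Q|P)>1$, is finite. More precisely, if a place $P$ of $F_0$ belongs to this set, then either $P$ is the pole of $x_0$, or $P$ is the zero of $x_0-\gamma$ for some $\gamma\in S_0$ (i.e. $x_0$ is regular at $P$ and, for some $\mathbb{F}_q$-embedding of the residue field of $P$ into $\overline{\mathbb{F}}_q$, the residue class $x_0(P)$ goes to $\gamma$). -/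

import Mathlib

open Polynomial IntermediateField

namespace FunctionFieldSeq

/-- `F / k` is an algebraic function field of one variable: a finite extension of a rational
function field `k(t)`, with `t` transcendental over `k`. -/
def IsFunctionField (k F : Type*) [Field k] [Field F] [Algebra k F] : Prop :=
  ∃ t : F, Transcendental k t ∧ FiniteDimensional k⟮t⟯ F

/-! ### Places -/

/-- A place of `F / k`, given by its valuation ring `𝒪_P`: a valuation ring of `F` which contains
`k` and is different from `F`. The place itself is the maximal ideal of this ring. -/
@[ext]
structure Place (k F : Type*) [Field k] [Field F] [Algebra k F] where
  /-- the valuation ring `𝒪_P` -/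
  ring : ValuationSubring F
  algebraMap_mem : ∀ c : k, algebraMap k F c ∈ ring
  ne_top : ring ≠ ⊤

namespace Place

variable {k F E : Type*} [Field k] [Field F] [Field E] [Algebra k F] [Algebra k E]

/-- For an extension of fields `f : F → E`, the place `Q` of `E` lies over the place `P` of `F`,
i.e. `𝒪_P = 𝒪_Q ∩ F`. -/
def LiesOver (f : F →ₐ[k] E) (Q : Place k E) (P : Place k F) : Prop :=
  Q.ring.comap (f : F →+* E) = P.ring

/-- For an extension of fields `f : F → E` and a place `Q` of `E`, the ramification index
`e(Q | Q ∩ F) = (v_Q(Eˣ) : v_Q(Fˣ))`. The value group `v_Q(Eˣ)` is `Eˣ` modulo the units of `𝒪_Q`,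
so this is the index of the subgroup `Fˣ · 𝒪_Qˣ` of `Eˣ`. -/
noncomputable def ramificationIdx (f : F →ₐ[k] E) (Q : Place k E) : ℕ :=
  ((Units.map (f : F →* E)).range ⊔ Q.ring.unitGroup).index

/-- `P` is a pole of `z`. -/
def IsPole (P : Place k F) (z : F) : Prop := z ∉ P.ring

/-- `z(P) = γ`, where `γ` lies in an extension field `L` of `k`: the element `z` is regular at `P`
and the residue field of `P` embeds over `k` into `L` in such a way that the residue class of `z`
goes to `γ`. (For `L` an algebraic closure of `k` this says that `P` is the zero of `z - γ`;
for `γ ∈ k` it says `z - γ ∈ P`.) -/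
def HasValue {L : Type*} [Field L] [Algebra k L] (P : Place k F) (z : F) (γ : L) : Prop :=
  ∃ (hz : z ∈ P.ring) (φ : IsLocalRing.ResidueField P.ring →+* L),
    (∀ c : k, φ (IsLocalRing.residue P.ring ⟨algebraMap k F c, P.algebraMap_mem c⟩)
      = algebraMap k L c) ∧
    φ (IsLocalRing.residue P.ring ⟨z, hz⟩) = γ

end Place

/-! ### Increasing sequences of fields `F 0 ≤ F 1 ≤ ⋯` over `k`, inside a common field `Ω` -/

section Sequences

variable {k Ω : Type*} [Field k] [Field Ω] [Algebra k Ω]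

/-- The inclusion map `F i → F j`, for `i ≤ j`. -/
def incl (F : ℕ →o IntermediateField k Ω) {i j : ℕ} (h : i ≤ j) : F i →ₐ[k] F j :=
  IntermediateField.inclusion (F.monotone h)

/-- Admissible sequences of function fields over `k`. -/
structure IsAdmissible (F : ℕ →o IntermediateField k Ω) : Prop where
  functionField : ∀ i, IsFunctionField k (F i)
  ssubset : ∀ i, F i < F (i + 1)
  finite : ∀ i, FiniteDimensional (F i) (extendScalars (F.monotone (Nat.le_succ i)))
  separable : ∀ i, Algebra.IsSeparable (F i) (extendScalars (F.monotone (Nat.le_succ i)))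
  /-- `k` is the full constant field of each `F i`. -/
  constants : ∀ i, ∀ z : F i, IsAlgebraic k z → z ∈ (algebraMap k (F i)).range

/-- All the extensions `F n / F 0` are tame. -/
def IsTame (F : ℕ →o IntermediateField k Ω) : Prop :=
  ∀ (n : ℕ) (P : Place k (F 0)) (Q : Place k (F n)), Q.LiesOver (incl F (Nat.zero_le n)) P →
    Nat.Coprime (Q.ramificationIdx (incl F (Nat.zero_le n))) (ringChar k)

/-- The ramification locus over `F 0`: the places of `F 0` which are ramified in some `F n / F 0`. -/
def ramLocus (F : ℕ →o IntermediateField k Ω) : Set (Place k (F 0)) :=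
  {P | ∃ (n : ℕ) (Q : Place k (F n)), Q.LiesOver (incl F (Nat.zero_le n)) P ∧
    1 < Q.ramificationIdx (incl F (Nat.zero_le n))}

/-- The sequence `F` is defined recursively by the equation `y ^ m = b₁(x) / b₂(x)`, by means of the
elements `x i ∈ F i`: `F 0 = k(x 0)` is a rational function field, `F (i+1) = F i (x (i+1))`, and
`x (i+1) ^ m = b₁(x i) / b₂(x i)`. -/
structure IsKummerRecursive (m : ℕ) (b₁ b₂ : k[X]) (F : ℕ →o IntermediateField k Ω)
    (x : (i : ℕ) → F i) : Prop where
  transcendental : Transcendental k (x 0)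
  zero : F 0 = k⟮(x 0 : Ω)⟯
  succ : ∀ i, F (i + 1) = ((F i)⟮(x (i + 1) : Ω)⟯).restrictScalars k
  equation : ∀ i, (x (i + 1) : Ω) ^ m = aeval (x i : Ω) b₁ / aeval (x i : Ω) b₂

end Sequences

/-- The set `Z_g` of zeros in `L` of a polynomial `g`. -/
def zeroSet {L : Type*} [Field L] (g : L[X]) : Set L := {β | g.eval β = 0}

/-- The polynomial `σ_γ(T) = b₂(T) γ ^ m - b₁(T)`. -/
noncomputable def sigma {k L : Type*} [Field k] [Field L] [Algebra k L] (m : ℕ) (b₁ b₂ : k[X])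
    (γ : L) : L[X] :=
  b₂.map (algebraMap k L) * C (γ ^ m) - b₁.map (algebraMap k L)

end FunctionFieldSeq

/-!
The proof has three ingredients: the degrees of the steps, the ramification in a single Kummer step,
and the propagation of the values of the `x i` at a place.

*Degrees.* Every step `F (n + 1) / F n` has degree exactly `m`, over any constant field
(`IsKummerRecursive.relfinrank_succ`). It has degree at most `m`, since `x (n + 1) ^ m ∈ F n`. For the
other inequality the sign of `r` matters. If `r > 0`, then all `x i` have a pole at a place over the
pole of `x 0`, with `v(x n) ^ (m ^ n) = v(x 0) ^ (r ^ n)`, so that this place is totally ramified. If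
`r < 0`, the element `x 1` vanishes at the pole of `x 0` and this argument breaks down; instead
`[F n : k(x n)] = (m - r) ^ n` is prime to `m`, whereas `[k(x n, x (n + 1)) : k(x n)] = m`, so that `m`
divides `[F (n + 1) : F n]`. As the degrees do not change when the constant field is enlarged by an
algebraic element `z` of `F n`, such a `z` lies in `k(x 0)` and hence in `k`.

*Ramification of a Kummer step.* Let `E = F(y)` with `y ^ m ∈ F` be a step of degree `m`, and `v` a
valuation of `E`. An element `z = ∑ c i * y ^ i` with `v(σ z) ≤ v(z)` for all conjugates satisfies
`v(c i * y ^ i) ≤ v(z)`, because `m * c i * y ^ i` is a combination of the `σ z` with roots of unity as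
coefficients; so `v(z)` is the value of some `c i * y ^ i`. Every value is attained at such an
element, by approximation (`exists_valuation_smul_le`), and so the value group of `E` is generated by
that of `F` and `v(y)` (`exists_valuation_eq_mul_pow`). Hence the ramification index divides `m`, and
is `1` if `y` is a unit. By multiplicativity the indices in `F n / F 0` divide `m ^ n`, and are `1`
where `x 1, …, x n` are units (`IsKummerRecursive.index_unitsSup_zero`). No decomposition groups and
no integral closures are needed.

*Values.* The hypotheses on `S₀` say that a value `x i (Q) ∉ S₀` is followed by a nonzero finite
value `x (i + 1) (Q) ∉ S₀` (`IsResidueHom.succ_notMem`). So a place of `F 0` at which `x 0` has a finite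
value outside `S₀` is unramified. There are only finitely many other places, since a place of
`k(x 0)` is determined by the value of `x 0`.
-/

namespace FunctionFieldSeq

/-! ### Valuations at a pole of a transcendental element -/

section Degrees

variable {K Ω : Type*} [Field K] [Field Ω] [Algebra K Ω]

theorem exists_valuationSubring_inv_mem_nonunits {x : Ω} (hx : Transcendental K x) :
    ∃ A : ValuationSubring Ω, (∀ c : K, algebraMap K Ω c ∈ A) ∧ x⁻¹ ∈ A.nonunits := by
  let R : Subring Ω := (Algebra.adjoin K {x⁻¹}).toSubring
  have hmem : x⁻¹ ∈ R := Algebra.self_mem_adjoin_singleton K x⁻¹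
  have hx0 : x ≠ 0 := by
    rintro rfl
    exact hx isAlgebraic_zero
  have hI : Ideal.span {(⟨x⁻¹, hmem⟩ : R)} ≠ ⊤ := by
    rw [Ne, Ideal.span_singleton_eq_top, isUnit_iff_exists_inv]
    rintro ⟨⟨b, hb⟩, h⟩
    have hbx : x⁻¹ * b = 1 := congrArg Subtype.val h
    obtain ⟨p, hp⟩ := (Algebra.adjoin_singleton_eq_range_aeval K x⁻¹).le hb
    have hp' : aeval x⁻¹ p = b := hp
    have hinv : IsAlgebraic K x⁻¹ := by
      refine ⟨X * p - 1, fun h0 ↦ ?_, by simp [hp', hbx]⟩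
      simpa using congrArg (eval 0) h0
    exact hx (by simpa using hinv.inv)
  obtain ⟨A, hRA, hA⟩ := Ideal.image_subset_nonunits_valuationSubring _ hI
  exact ⟨A, fun c ↦ hRA (Subalgebra.algebraMap_mem _ c),
    hA ⟨_, Ideal.mem_span_singleton_self _, rfl⟩⟩

theorem valuation_algebraMap_eq_one (A : ValuationSubring Ω)
    (hA : ∀ c : K, algebraMap K Ω c ∈ A) {c : K} (hc : c ≠ 0) :
    A.valuation (algebraMap K Ω c) = 1 := by
  refine le_antisymm ((A.valuation_le_one_iff _).2 (hA c)) ?_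
  have := (A.valuation_le_one_iff _).2 (hA c⁻¹)
  rw [map_inv₀, map_inv₀] at this
  exact (inv_le_one₀ (zero_lt_iff.2 (by simpa using hc))).1 this

/-- At a place at which `x` has a pole, `v(p(x)) = v(x) ^ deg p`. -/
theorem valuation_aeval {Γ : Type*} [LinearOrderedCommGroupWithZero Γ] (v : Valuation Ω Γ)
    (hv : ∀ c : K, c ≠ 0 → v (algebraMap K Ω c) = 1) {x : Ω} (hx : 1 < v x) {p : K[X]}
    (hp : p ≠ 0) : v (aeval x p) = v x ^ p.natDegree := by
  classical
  have hlc : v (p.coeff p.natDegree • x ^ p.natDegree) = v x ^ p.natDegree := by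
    rw [Algebra.smul_def, map_mul, hv _ (by simpa using hp), one_mul, map_pow]
  rw [aeval_eq_sum_range, v.map_sum_eq_of_lt (j := p.natDegree) (by simp), hlc]
  intro i hi
  rw [hlc, Algebra.smul_def, map_mul, map_pow]
  simp only [Finset.mem_sdiff, Finset.mem_range, Finset.mem_singleton] at hi
  have hlt : v x ^ i < v x ^ p.natDegree := pow_lt_pow_right₀ hx (by omega)
  by_cases h : p.coeff i = 0
  · rw [h, map_zero, map_zero, zero_mul]
    exact pow_pos (zero_lt_one.trans hx) _
  · rwa [hv _ h, one_mul]

theorem exists_valuation_eq_zpow {Γ : Type*} [LinearOrderedCommGroupWithZero Γ]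
    (v : Valuation Ω Γ) (hv : ∀ c : K, c ≠ 0 → v (algebraMap K Ω c) = 1) {x : Ω} (hx : 1 < v x)
    {a : Ω} (ha : a ∈ K⟮x⟯) (ha0 : a ≠ 0) : ∃ n : ℤ, v a = v x ^ n := by
  obtain ⟨p, q, rfl⟩ := (mem_adjoin_simple_iff K a).1 ha
  have hp : p ≠ 0 := by rintro rfl; simp at ha0
  have hq : q ≠ 0 := by rintro rfl; simp at ha0
  have hx0 : v x ≠ 0 := (zero_lt_one.trans hx).ne'
  refine ⟨p.natDegree - q.natDegree, ?_⟩
  rw [map_div₀, valuation_aeval v hv hx hp, valuation_aeval v hv hx hq, zpow_sub₀ hx0,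
    zpow_natCast, zpow_natCast]

/-- Finitely many elements whose nonzero members have pairwise distinct values have a nonzero sum,
unless all of them vanish. -/
theorem sum_ne_zero_of_valuation_injOn {Γ ι : Type*} [LinearOrderedCommGroupWithZero Γ]
    (v : Valuation Ω Γ) (s : Finset ι) (f : ι → Ω)
    (hf : ∀ i ∈ s, ∀ j ∈ s, f i ≠ 0 → f j ≠ 0 → v (f i) = v (f j) → i = j)
    {i₀ : ι} (hi₀ : i₀ ∈ s) (h₀ : f i₀ ≠ 0) : ∑ i ∈ s, f i ≠ 0 := by
  classical
  obtain ⟨j, hj, hmax⟩ := s.exists_max_image (fun i ↦ v (f i)) ⟨i₀, hi₀⟩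
  have hj0 : f j ≠ 0 := by
    rw [← v.ne_zero_iff]
    exact ((zero_lt_iff.2 (v.ne_zero_iff.2 h₀)).trans_le (hmax _ hi₀)).ne'
  rw [← v.ne_zero_iff, v.map_sum_eq_of_lt hj]
  · exact v.ne_zero_iff.2 hj0
  · intro i hi
    simp only [Finset.mem_sdiff, Finset.mem_singleton] at hi
    refine lt_of_le_of_ne (hmax _ hi.1) fun h ↦ ?_
    by_cases hi0 : f i = 0
    · rw [hi0, map_zero] at h
      exact hj0 ((map_eq_zero v).1 h.symm)
    · exact hi.2 (hf _ hi.1 _ hj hi0 hj0 h)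

/-- If `v(y) ^ M = v(x) ^ R` with `M` and `R` coprime, at a place at which `x` has a pole, then
this place ramifies in `K(x, y) / K(x)` with index divisible by `M`; so the degree of `y` over
`K(x)` is at least `M`. -/
theorem le_natDegree_minpoly_of_valuation {Γ : Type*} [LinearOrderedCommGroupWithZero Γ]
    (v : Valuation Ω Γ) (hv : ∀ c : K, c ≠ 0 → v (algebraMap K Ω c) = 1) {x y : Ω} (hx : 1 < v x)
    {M : ℕ} {R : ℤ} (hMR : IsCoprime (M : ℤ) R) (hy0 : y ≠ 0) (hxy : v y ^ M = v x ^ R)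
    (hy : IsIntegral K⟮x⟯ y) : M ≤ (minpoly K⟮x⟯ y).natDegree := by
  by_contra! hlt
  set p := minpoly K⟮x⟯ y
  have hx0 : v x ≠ 0 := (zero_lt_one.trans hx).ne'
  have hvy : v y ≠ 0 := v.ne_zero_iff.2 hy0
  have hsum : ∑ i ∈ Finset.range (p.natDegree + 1), ((p.coeff i : K⟮x⟯) : Ω) * y ^ i = 0 := by
    have := minpoly.aeval K⟮x⟯ y
    rw [aeval_eq_sum_range] at this
    simpa [Algebra.smul_def] using this
  refine sum_ne_zero_of_valuation_injOn v (Finset.range (p.natDegree + 1))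
    (fun i ↦ ((p.coeff i : K⟮x⟯) : Ω) * y ^ i) ?_ (i₀ := p.natDegree) (by simp) ?_ hsum
  · intro i hi j hj hfi hfj hij
    obtain ⟨a, ha⟩ := exists_valuation_eq_zpow v hv hx (p.coeff i).2 (left_ne_zero_of_mul hfi)
    obtain ⟨b, hb⟩ := exists_valuation_eq_zpow v hv hx (p.coeff j).2 (left_ne_zero_of_mul hfj)
    simp only [map_mul, map_pow, ha, hb] at hij
    -- raising to the power `M` turns the equality of values into one of exponents of `v x`
    have hpow : v x ^ (a * M + R * i) = v x ^ (b * M + R * j) := by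
      have := congrArg (· ^ M) hij
      simp only [mul_pow, ← pow_mul, mul_comm _ M] at this
      rw [pow_mul, pow_mul, hxy] at this
      rw [zpow_add₀ hx0, zpow_add₀ hx0, zpow_mul, zpow_mul, zpow_mul, zpow_mul]
      exact_mod_cast this
    have hexp := zpow_right_injective₀ (zero_lt_one.trans hx) hx.ne' hpow
    have hdvd : (M : ℤ) ∣ (j : ℤ) - i := by
      refine hMR.dvd_of_dvd_mul_left ⟨a - b, ?_⟩
      linear_combination -hexp
    simp only [Finset.mem_range] at hi hj
    have := Int.eq_zero_of_abs_lt_dvd hdvd (by rw [abs_lt]; constructor <;> omega)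
    omega
  · have hmonic : p.Monic := minpoly.monic hy
    simp [hmonic.coeff_natDegree, hy0]

end Degrees

/-! ### Degrees of rational functions -/

section Rational

variable {K Ω : Type*} [Field K] [Field Ω] [Algebra K Ω]

/-- The embedding `K(X) → Ω` with `X ↦ x`, for `x` transcendental. -/
noncomputable def ratFuncHom {x : Ω} (hx : Transcendental K x) : RatFunc K →ₐ[K] Ω :=
  RatFunc.liftAlgHom (aeval x) fun p hp ↦ by
    rw [Submonoid.mem_comap, mem_nonZeroDivisors_iff_ne_zero]
    exact fun h ↦ nonZeroDivisors.ne_zero hp (transcendental_iff.1 hx p h)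

theorem ratFuncHom_algebraMap {x : Ω} (hx : Transcendental K x) (p : K[X]) :
    ratFuncHom hx (algebraMap K[X] (RatFunc K) p) = aeval x p := by
  have h := RatFunc.liftAlgHom_apply_div (φ := aeval (R := K) x) (hφ := fun p hp ↦ by
    rw [Submonoid.mem_comap, mem_nonZeroDivisors_iff_ne_zero]
    exact fun h ↦ nonZeroDivisors.ne_zero hp (transcendental_iff.1 hx p h)) p 1
  simp only [map_one, div_one] at h
  exact h

theorem map_ratFuncHom_adjoin {x : Ω} (hx : Transcendental K x) (f : RatFunc K) :
    (K⟮f⟯).map (ratFuncHom hx) = K⟮ratFuncHom hx f⟯ := by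
  simp [adjoin_map]

theorem fieldRange_ratFuncHom {x : Ω} (hx : Transcendental K x) :
    (⊤ : IntermediateField K (RatFunc K)).map (ratFuncHom hx) = K⟮x⟯ := by
  rw [← RatFunc.adjoin_X, map_ratFuncHom_adjoin, ← RatFunc.algebraMap_X, ratFuncHom_algebraMap,
    aeval_X]

/-- An element of `K(x)` is algebraic over `K` only if it is constant. -/
theorem mem_range_of_isAlgebraic_of_mem_adjoin {x z : Ω} (hx : Transcendental K x)
    (hz : z ∈ K⟮x⟯) (hz' : IsAlgebraic K z) : z ∈ (algebraMap K Ω).range := by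
  rw [← fieldRange_ratFuncHom hx] at hz
  obtain ⟨f, -, rfl⟩ := hz
  by_cases hf : ∃ c, f = RatFunc.C c
  · obtain ⟨c, rfl⟩ := hf
    exact ⟨c, ((ratFuncHom hx).commutes c).symm⟩
  · exact absurd ((isAlgebraic_algHom_iff _ (ratFuncHom hx).toRingHom.injective).1 hz')
      (f.transcendental_of_ne_C hf)

/-- `[K(x) : K(p(x)/q(x))] = max (deg p) (deg q)` for a reduced fraction `p/q`. -/
theorem relfinrank_adjoin_div {x : Ω} (hx : Transcendental K x) {p q : K[X]} (hpq : IsCoprime p q)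
    (hq : q ≠ 0) :
    relfinrank K⟮aeval x p / aeval x q⟯ K⟮x⟯ = max p.natDegree q.natDegree := by
  classical
  set f : RatFunc K := algebraMap K[X] (RatFunc K) p / algebraMap K[X] (RatFunc K) q with hf
  have hfx : ratFuncHom hx f = aeval x p / aeval x q := by
    rw [hf, map_div₀, ratFuncHom_algebraMap, ratFuncHom_algebraMap]
  have hmul : f.num * q = p * f.denom := (RatFunc.num_mul_eq_mul_denom_iff hq).2 rfl
  have hnum : f.num.natDegree = p.natDegree :=
    natDegree_eq_of_degree_eq (degree_eq_degree_of_associated (associated_of_dvd_dvd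
      (RatFunc.num_div_dvd p hq) (hpq.dvd_of_dvd_mul_right ⟨_, hmul⟩)))
  have hden : f.denom.natDegree = q.natDegree :=
    natDegree_eq_of_degree_eq (degree_eq_degree_of_associated (associated_of_dvd_dvd
      (RatFunc.denom_div_dvd p q)
      (hpq.symm.dvd_of_dvd_mul_left ⟨f.num, by rw [← hmul, mul_comm]⟩)))
  rw [← hfx, ← map_ratFuncHom_adjoin, ← fieldRange_ratFuncHom hx, relfinrank_map_map,
    relfinrank_top_right, RatFunc.finrank_eq_max_natDegree, hnum, hden]

/-- A nonconstant rational function of a transcendental element is transcendental. -/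
theorem transcendental_div {x : Ω} (hx : Transcendental K x) {p q : K[X]} (hpq : IsCoprime p q)
    (hq : q ≠ 0) (hp : 0 < p.natDegree) : Transcendental K (aeval x p / aeval x q) := by
  intro halg
  have hqx : aeval x q ≠ 0 := fun h ↦ hq (transcendental_iff.1 hx q h)
  obtain ⟨c, hc⟩ := mem_range_of_isAlgebraic_of_mem_adjoin hx
    ((mem_adjoin_simple_iff K _).2 ⟨p, q, rfl⟩) halg
  have hpc : p = C c * q := by
    rw [← sub_eq_zero]
    refine transcendental_iff.1 hx _ ?_
    rw [map_sub, map_mul, aeval_C, hc, div_mul_cancel₀ _ hqx, sub_self]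
  have hunit : IsUnit q := hpq.symm.isUnit_of_dvd' dvd_rfl ⟨C c, by rw [hpc, mul_comm]⟩
  rw [hpc] at hp
  have := natDegree_C_mul_le c q
  rw [natDegree_eq_zero_of_isUnit hunit] at this
  omega

theorem ne_zero_of_transcendental {x : Ω} (hx : Transcendental K x) : x ≠ 0 := by
  rintro rfl
  exact hx isAlgebraic_zero

theorem isIntegral_of_pow_mem {m : ℕ} (hm : 0 < m) {A : IntermediateField K Ω} {y : Ω}
    (hy : y ^ m ∈ A) : IsIntegral A y :=
  IsIntegral.of_pow hm (isIntegral_algebraMap (R := A) (x := ⟨y ^ m, hy⟩))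

theorem relfinrank_adjoin_simple {A : IntermediateField K Ω} {y : Ω} (hy : IsIntegral A y) :
    relfinrank A (A⟮y⟯.restrictScalars K) = (minpoly A y).natDegree := by
  have hle : A ≤ A⟮y⟯.restrictScalars K := fun a ha ↦
    IntermediateField.algebraMap_mem A⟮y⟯ (⟨a, ha⟩ : A)
  rw [relfinrank_eq_finrank_of_le hle, ← adjoin.finrank hy]
  rfl

theorem natDegree_minpoly_le_of_pow_mem {m : ℕ} (hm : 0 < m) {A : IntermediateField K Ω} {y : Ω}
    (hy : y ^ m ∈ A) : (minpoly A y).natDegree ≤ m := by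
  have h0 : (X ^ m - C (⟨y ^ m, hy⟩ : A)) ≠ 0 := X_pow_sub_C_ne_zero hm _
  have h : aeval y (X ^ m - C (⟨y ^ m, hy⟩ : A)) = 0 := by
    simp [IntermediateField.algebraMap_apply]
  simpa using natDegree_le_of_dvd (minpoly.dvd A y h) h0

/-- A transcendental element has a pole at some place that is trivial on `K`. -/
theorem exists_valuationSubring_one_lt {x : Ω} (hx : Transcendental K x) :
    ∃ A : ValuationSubring Ω, (∀ c : K, c ≠ 0 → A.valuation (algebraMap K Ω c) = 1) ∧
      1 < A.valuation x := by
  obtain ⟨A, hA, hxA⟩ := exists_valuationSubring_inv_mem_nonunits hx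
  refine ⟨A, fun c ↦ valuation_algebraMap_eq_one A hA, ?_⟩
  rw [ValuationSubring.mem_nonunits_iff, map_inv₀] at hxA
  exact (inv_lt_one₀ (zero_lt_iff.2 (by simpa using ne_zero_of_transcendental hx))).1 hxA

end Rational

/-! ### The degrees of the steps -/

section RecursiveDegrees

variable {K Ω : Type*} [Field K] [Field Ω] [Algebra K Ω] {m : ℕ} {b₁ b₂ : K[X]}
  {F : ℕ →o IntermediateField K Ω} {x : (i : ℕ) → F i}

theorem ne_zero_of_natDegree_eq_sub {r : ℤ} (hm : 2 ≤ m) (hb₂ : (b₂.natDegree : ℤ) = m - r)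
    (hr : Int.gcd m r = 1) : b₂ ≠ 0 := by
  rintro rfl
  obtain rfl : (m : ℤ) = r := by simpa [sub_eq_zero, eq_comm] using hb₂
  simp at hr
  omega

theorem IsKummerRecursive.transcendental_coe (hF : IsKummerRecursive m b₁ b₂ F x)
    (hcop : IsCoprime b₁ b₂) (hb₁ : 0 < b₁.natDegree) (hb₂ : b₂ ≠ 0) (i : ℕ) :
    Transcendental K (x i : Ω) := by
  induction i with
  | zero =>
    intro h
    exact hF.transcendental ((isAlgebraic_algHom_iff (F 0).val (F 0).val.injective).1 h)
  | succ i ih =>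
    intro h
    exact transcendental_div ih hcop hb₂ hb₁ (hF.equation i ▸ h.pow m)

theorem IsKummerRecursive.pow_mem (hF : IsKummerRecursive m b₁ b₂ F x) (i : ℕ) :
    (x (i + 1) : Ω) ^ m ∈ K⟮(x i : Ω)⟯ := by
  rw [hF.equation]
  exact (mem_adjoin_simple_iff K _).2 ⟨b₁, b₂, rfl⟩

theorem IsKummerRecursive.adjoin_le (_ : IsKummerRecursive m b₁ b₂ F x) (i : ℕ) :
    K⟮(x i : Ω)⟯ ≤ F i :=
  adjoin_simple_le_iff.2 (x i).2

theorem IsKummerRecursive.isIntegral (hF : IsKummerRecursive m b₁ b₂ F x) (hm : 0 < m) (i : ℕ) :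
    IsIntegral (F i) (x (i + 1) : Ω) :=
  isIntegral_of_pow_mem hm (hF.adjoin_le i (hF.pow_mem i))

theorem IsKummerRecursive.relfinrank_succ_le (hF : IsKummerRecursive m b₁ b₂ F x) (hm : 0 < m)
    (i : ℕ) : relfinrank (F i) (F (i + 1)) ≤ m := by
  rw [hF.succ, relfinrank_adjoin_simple (hF.isIntegral hm i)]
  exact natDegree_minpoly_le_of_pow_mem hm (hF.adjoin_le i (hF.pow_mem i))

theorem IsKummerRecursive.relfinrank_succ_pos (hF : IsKummerRecursive m b₁ b₂ F x) (hm : 0 < m)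
    (i : ℕ) : 0 < relfinrank (F i) (F (i + 1)) := by
  rw [hF.succ, relfinrank_adjoin_simple (hF.isIntegral hm i)]
  exact minpoly.natDegree_pos (hF.isIntegral hm i)

theorem relfinrank_zero_succ (i : ℕ) : relfinrank (F 0) (F (i + 1)) =
    relfinrank (F 0) (F i) * relfinrank (F i) (F (i + 1)) :=
  (relfinrank_mul_relfinrank (F.monotone (Nat.zero_le i)) (F.monotone (Nat.le_succ i))).symm

theorem IsKummerRecursive.relfinrank_zero_pos (hF : IsKummerRecursive m b₁ b₂ F x) (hm : 0 < m)
    (i : ℕ) : 0 < relfinrank (F 0) (F i) := by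
  induction i with
  | zero => simp
  | succ i ih =>
    rw [relfinrank_zero_succ]
    exact Nat.mul_pos ih (hF.relfinrank_succ_pos hm i)

theorem IsKummerRecursive.relfinrank_zero_le (hF : IsKummerRecursive m b₁ b₂ F x) (hm : 0 < m)
    (i : ℕ) : relfinrank (F 0) (F i) ≤ m ^ i := by
  induction i with
  | zero => simp
  | succ i ih =>
    rw [relfinrank_zero_succ, pow_succ]
    exact Nat.mul_le_mul ih (hF.relfinrank_succ_le hm i)

theorem valuation_eq_zpow_of_pow_eq_div {Γ : Type*} [LinearOrderedCommGroupWithZero Γ]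
    (v : Valuation Ω Γ) (hv : ∀ c : K, c ≠ 0 → v (algebraMap K Ω c) = 1) {r : ℤ}
    (hb₁ : b₁.natDegree = m) (hb₂ : (b₂.natDegree : ℤ) = m - r) (hb₁' : b₁ ≠ 0) (hb₂' : b₂ ≠ 0)
    {a y : Ω} (ha : 1 < v a) (hy : y ^ m = aeval a b₁ / aeval a b₂) : v y ^ m = v a ^ r := by
  rw [← map_pow, hy, map_div₀, valuation_aeval v hv ha hb₁', valuation_aeval v hv ha hb₂', hb₁,
    ← zpow_natCast, ← zpow_natCast, hb₂, ← zpow_sub₀ (zero_lt_one.trans ha).ne', sub_sub_cancel]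

/-- For `r > 0` the pole of `x 0` is totally ramified in `F n`, all `x i` having poles there. -/
theorem IsKummerRecursive.pow_le_relfinrank_of_pos (hF : IsKummerRecursive m b₁ b₂ F x)
    (hm : 2 ≤ m) (hcop : IsCoprime b₁ b₂) {r : ℤ} (hb₁ : b₁.natDegree = m)
    (hb₂ : (b₂.natDegree : ℤ) = m - r) (hr : Int.gcd m r = 1) (hr0 : 0 < r) (n : ℕ) :
    m ^ n ≤ relfinrank (F 0) (F n) := by
  have hb₂' := ne_zero_of_natDegree_eq_sub hm hb₂ hr
  have hb₁' : b₁ ≠ 0 := by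
    rintro rfl
    simp at hb₁
    omega
  have htr := hF.transcendental_coe hcop (by omega) hb₂'
  obtain ⟨A, hA, hxA⟩ := exists_valuationSubring_one_lt (htr 0)
  have hval : ∀ i, 1 < A.valuation (x i : Ω) ∧
      A.valuation (x i : Ω) ^ m ^ i = A.valuation (x 0 : Ω) ^ r ^ i := by
    intro i
    induction i with
    | zero => simp [hxA]
    | succ i ih =>
      have h := valuation_eq_zpow_of_pow_eq_div A.valuation hA hb₁ hb₂ hb₁' hb₂' ih.1 (hF.equation i)
      refine ⟨?_, ?_⟩
      · rw [← one_lt_pow_iff_of_nonneg zero_le (by omega : m ≠ 0), h]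
        exact one_lt_zpow₀ ih.1 hr0
      · rw [pow_succ', pow_mul, h, pow_succ, zpow_mul, ← ih.2, ← zpow_natCast, ← zpow_natCast,
          zpow_comm]
  have hpos := hF.relfinrank_zero_pos (by omega) n
  have hle : F 0 ≤ F n := F.monotone (Nat.zero_le n)
  have hint : IsIntegral (F 0) (x n : Ω) := by
    rw [relfinrank_eq_finrank_of_le hle] at hpos
    have : FiniteDimensional (F 0) (extendScalars hle) := FiniteDimensional.of_finrank_pos hpos
    have := Algebra.IsIntegral.isIntegral (R := F 0) (⟨x n, (x n).2⟩ : extendScalars hle)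
    exact this.map (extendScalars hle).val
  have hdeg : m ^ n ≤ (minpoly (F 0) (x n : Ω)).natDegree := by
    have hcopr : IsCoprime ((m ^ n : ℕ) : ℤ) (r ^ n) := by
      push_cast
      exact (Int.isCoprime_iff_gcd_eq_one.2 hr).pow
    have key := fun h ↦ le_natDegree_minpoly_of_valuation A.valuation hA hxA hcopr
      (ne_zero_of_transcendental (htr n)) (hval n).2 h
    rw [← hF.zero] at key
    exact key hint
  rw [← relfinrank_adjoin_simple hint] at hdeg
  refine hdeg.trans (Nat.le_of_dvd hpos ?_)
  refine ⟨_, (relfinrank_mul_relfinrank ?_ ?_).symm⟩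
  · exact fun a ha ↦ IntermediateField.algebraMap_mem (F 0)⟮(x n : Ω)⟯ (⟨a, ha⟩ : F 0)
  · rw [restrictScalars_adjoin_eq_sup]
    exact sup_le hle (adjoin_simple_le_iff.2 (x n).2)

/-- The pole of `a` is totally ramified in `K(a, y) / K(a)`, whose degree is therefore `m`. -/
theorem relfinrank_left_of_pow_eq_div (hm : 2 ≤ m) {r : ℤ} (hb₁ : b₁.natDegree = m)
    (hb₂ : (b₂.natDegree : ℤ) = m - r) (hr : Int.gcd m r = 1) {a y : Ω} (ha : Transcendental K a)
    (hy : Transcendental K y) (hay : y ^ m = aeval a b₁ / aeval a b₂) :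
    relfinrank K⟮a⟯ (K⟮a⟯ ⊔ K⟮y⟯) = m := by
  have hb₁' : b₁ ≠ 0 := by
    rintro rfl
    simp at hb₁
    omega
  have hmem : y ^ m ∈ K⟮a⟯ := (mem_adjoin_simple_iff K _).2 ⟨b₁, b₂, hay⟩
  have hint : IsIntegral K⟮a⟯ y := isIntegral_of_pow_mem (by omega) hmem
  rw [← restrictScalars_adjoin_eq_sup, relfinrank_adjoin_simple hint]
  refine le_antisymm (natDegree_minpoly_le_of_pow_mem (by omega) hmem) ?_
  obtain ⟨V, hV, hxV⟩ := exists_valuationSubring_one_lt ha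
  exact le_natDegree_minpoly_of_valuation V.valuation hV hxV (Int.isCoprime_iff_gcd_eq_one.2 hr)
    (ne_zero_of_transcendental hy)
    (valuation_eq_zpow_of_pow_eq_div V.valuation hV hb₁ hb₂ hb₁'
      (ne_zero_of_natDegree_eq_sub hm hb₂ hr) hxV hay) hint

theorem relfinrank_right_of_pow_eq_div (hm : 0 < m) (hcop : IsCoprime b₁ b₂) (hb₂ : b₂ ≠ 0)
    {a y : Ω} (ha : Transcendental K a) (hy : Transcendental K y)
    (hay : y ^ m = aeval a b₁ / aeval a b₂) (hleft : relfinrank K⟮a⟯ (K⟮a⟯ ⊔ K⟮y⟯) = m) :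
    relfinrank K⟮y⟯ (K⟮a⟯ ⊔ K⟮y⟯) = max b₁.natDegree b₂.natDegree := by
  -- the degrees of `K(a)` and of `K(y)` over `K(y ^ m)` are known from the rational case
  have h₁ : relfinrank K⟮y ^ m⟯ K⟮a⟯ = max b₁.natDegree b₂.natDegree :=
    hay ▸ relfinrank_adjoin_div ha hcop hb₂
  have h₂ : relfinrank K⟮y ^ m⟯ K⟮y⟯ = m := by
    simpa using relfinrank_adjoin_div hy (p := (X : K[X]) ^ m) (q := 1) isCoprime_one_right
      one_ne_zero
  have hc₁ : K⟮y ^ m⟯ ≤ K⟮a⟯ :=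
    adjoin_simple_le_iff.2 ((mem_adjoin_simple_iff K _).2 ⟨b₁, b₂, hay⟩)
  have hc₂ : K⟮y ^ m⟯ ≤ K⟮y⟯ := adjoin_simple_le_iff.2 (pow_mem (mem_adjoin_simple_self K y) m)
  have e₁ := relfinrank_mul_relfinrank hc₁ (le_sup_left : K⟮a⟯ ≤ K⟮a⟯ ⊔ K⟮y⟯)
  have e₂ := relfinrank_mul_relfinrank hc₂ (le_sup_right : K⟮y⟯ ≤ K⟮a⟯ ⊔ K⟮y⟯)
  rw [h₁, hleft, ← e₂, h₂, mul_comm] at e₁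
  exact (Nat.eq_of_mul_eq_mul_left hm e₁).symm

/-- For `r < 0` the degree of `F n` over `K(x n)` is `(m - r) ^ n`, hence prime to `m`; this makes
the extension `F (n + 1) / F n`, of degree at most `m`, have degree exactly `m`. -/
theorem IsKummerRecursive.coprime_relfinrank_of_neg (hF : IsKummerRecursive m b₁ b₂ F x)
    (hm : 2 ≤ m) (hcop : IsCoprime b₁ b₂) {r : ℤ} (hb₁ : b₁.natDegree = m)
    (hb₂ : (b₂.natDegree : ℤ) = m - r) (hr : Int.gcd m r = 1) (hr0 : r < 0) (n : ℕ) :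
    Nat.Coprime m (relfinrank K⟮(x n : Ω)⟯ (F n)) ∧ relfinrank (F n) (F (n + 1)) = m := by
  have hb₂' := ne_zero_of_natDegree_eq_sub hm hb₂ hr
  have hb₁' : b₁ ≠ 0 := by
    rintro rfl
    simp at hb₁
    omega
  have htr := hF.transcendental_coe hcop (by omega) hb₂'
  let A (i : ℕ) : IntermediateField K Ω := K⟮(x i : Ω)⟯
  let B (i : ℕ) : IntermediateField K Ω := A i ⊔ A (i + 1)
  have hAF (i) : A i ≤ F i := hF.adjoin_le i
  have hF1 (i) : F i ≤ F (i + 1) := F.monotone (Nat.le_succ i)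
  have hBF (i) : B i ≤ F (i + 1) := sup_le ((hAF i).trans (hF1 i)) (hAF (i + 1))
  have hAB (i) : relfinrank (A i) (B i) = m :=
    relfinrank_left_of_pow_eq_div hm hb₁ hb₂ hr (htr i) (htr (i + 1)) (hF.equation i)
  have hAB' (i) : relfinrank (A (i + 1)) (B i) = b₂.natDegree := by
    rw [← max_eq_right (by omega : b₁.natDegree ≤ b₂.natDegree)]
    exact relfinrank_right_of_pow_eq_div (by omega) hcop hb₂' (htr i) (htr (i + 1)) (hF.equation i)
      (hAB i)
  have hstep (i) (h : Nat.Coprime m (relfinrank (A i) (F i))) :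
      relfinrank (F i) (F (i + 1)) = m ∧
        relfinrank (B i) (F (i + 1)) = relfinrank (A i) (F i) := by
    have e₁ := relfinrank_mul_relfinrank (hAF i) (hF1 i)
    have e₂ := relfinrank_mul_relfinrank (le_sup_left : A i ≤ B i) (hBF i)
    rw [hAB i, ← e₁] at e₂
    have hm' : relfinrank (F i) (F (i + 1)) = m :=
      le_antisymm (hF.relfinrank_succ_le (by omega) i) (Nat.le_of_dvd
        (hF.relfinrank_succ_pos (by omega) i) (h.dvd_of_dvd_mul_left ⟨_, e₂.symm⟩))
    refine ⟨hm', ?_⟩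
    rw [hm', mul_comm _ m] at e₂
    exact Nat.eq_of_mul_eq_mul_left (by omega) e₂
  have hcoprime : Nat.Coprime m b₂.natDegree := by
    rw [← Nat.isCoprime_iff_coprime, hb₂]
    simpa [sub_eq_neg_add, isCoprime_comm] using
      (IsCoprime.add_mul_left_right (Int.isCoprime_iff_gcd_eq_one.2 hr).neg_right 1)
  have hmain (i) : Nat.Coprime m (relfinrank (A i) (F i)) := by
    induction i with
    | zero => simp [A, hF.zero]
    | succ i ih =>
      rw [← relfinrank_mul_relfinrank (le_sup_right : A (i + 1) ≤ B i) (hBF i), hAB' i,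
        (hstep i ih).2]
      exact hcoprime.mul_right ih
  exact ⟨hmain n, (hstep n (hmain n)).1⟩

/-- Every step of the sequence has degree `m`. -/
theorem IsKummerRecursive.relfinrank_succ (hF : IsKummerRecursive m b₁ b₂ F x)
    (hm : 2 ≤ m) (hcop : IsCoprime b₁ b₂) {r : ℤ} (hb₁ : b₁.natDegree = m)
    (hb₂ : (b₂.natDegree : ℤ) = m - r) (hr : Int.gcd m r = 1) (n : ℕ) :
    relfinrank (F n) (F (n + 1)) = m := by
  rcases lt_trichotomy r 0 with h | rfl | h
  · exact (hF.coprime_relfinrank_of_neg hm hcop hb₁ hb₂ hr h n).2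
  · simp at hr
    omega
  · refine le_antisymm (hF.relfinrank_succ_le (by omega) n) ?_
    have h₁ := hF.pow_le_relfinrank_of_pos hm hcop hb₁ hb₂ hr h (n + 1)
    have h₂ := hF.relfinrank_zero_le (by omega) n
    rw [relfinrank_zero_succ, pow_succ] at h₁
    exact Nat.le_of_mul_le_mul_left (h₁.trans (Nat.mul_le_mul_right _ h₂)) (by positivity)

theorem IsKummerRecursive.relfinrank_zero (hF : IsKummerRecursive m b₁ b₂ F x)
    (hm : 2 ≤ m) (hcop : IsCoprime b₁ b₂) {r : ℤ} (hb₁ : b₁.natDegree = m)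
    (hb₂ : (b₂.natDegree : ℤ) = m - r) (hr : Int.gcd m r = 1) (n : ℕ) :
    relfinrank (F 0) (F n) = m ^ n := by
  induction n with
  | zero => simp
  | succ n ih => rw [relfinrank_zero_succ, ih, hF.relfinrank_succ hm hcop hb₁ hb₂ hr, pow_succ]

end RecursiveDegrees

/-! ### Constants and admissibility -/

section Admissible

variable {k Ω : Type*} [Field k] [Field Ω] [Algebra k Ω] {m : ℕ} {b₁ b₂ : k[X]}
  {F : ℕ →o IntermediateField k Ω} {x : (i : ℕ) → F i}

/-- The sequence of the composites `K · F i`, over a larger constant field `K`. -/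
def constantExtension (F : ℕ →o IntermediateField k Ω) (K : IntermediateField k Ω) :
    ℕ →o IntermediateField K Ω where
  toFun i := adjoin K (F i : Set Ω)
  monotone' _ _ h := adjoin.mono K _ _ (F.monotone h)

theorem coe_subset_constantExtension (K : IntermediateField k Ω) (i : ℕ) :
    (F i : Set Ω) ⊆ constantExtension F K i :=
  subset_adjoin K _

theorem IsKummerRecursive.constantExtension (hF : IsKummerRecursive m b₁ b₂ F x)
    (K : IntermediateField k Ω) [Algebra.IsAlgebraic k K] :
    IsKummerRecursive m (b₁.map (algebraMap k K)) (b₂.map (algebraMap k K))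
      (constantExtension F K) fun i ↦ ⟨x i, coe_subset_constantExtension K i (x i).2⟩ where
  transcendental h := by
    have h₁ : IsAlgebraic K (x 0 : Ω) :=
      h.algHom (FunctionFieldSeq.constantExtension F K 0).val
    have h₂ : IsAlgebraic k (x 0 : Ω) := h₁.restrictScalars k
    exact hF.transcendental ((isAlgebraic_algHom_iff (F 0).val (F 0).val.injective).1 h₂)
  zero := by
    refine le_antisymm (adjoin_le_iff.2 ?_) ?_
    · have : F 0 ≤ (K⟮(x 0 : Ω)⟯).restrictScalars k := by
        refine hF.zero.le.trans (adjoin_simple_le_iff.2 ?_)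
        exact mem_adjoin_simple_self K _
      exact this
    · exact adjoin_simple_le_iff.2 (coe_subset_constantExtension K 0 (x 0).2)
  succ i := by
    rw [restrictScalars_adjoin_eq_sup]
    refine le_antisymm (adjoin_le_iff.2 ?_) (sup_le
      ((FunctionFieldSeq.constantExtension F K).monotone (Nat.le_succ i)) ?_)
    · have : F (i + 1) ≤ (FunctionFieldSeq.constantExtension F K i ⊔
          K⟮(x (i + 1) : Ω)⟯).restrictScalars k := by
        refine (hF.succ i).le.trans ?_
        rw [restrictScalars_adjoin_eq_sup]
        refine sup_le (fun a ha ↦ ?_) (adjoin_simple_le_iff.2 ?_)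
        · exact (le_sup_left : FunctionFieldSeq.constantExtension F K i ≤ _)
            (coe_subset_constantExtension K i ha)
        · exact (le_sup_right : K⟮(x (i + 1) : Ω)⟯ ≤ _) (mem_adjoin_simple_self K _)
      exact this
    · exact adjoin_simple_le_iff.2 (coe_subset_constantExtension K _ (x (i + 1)).2)
  equation i := by
    simpa using hF.equation i

theorem constantExtension_toSubfield {K : IntermediateField k Ω} {n : ℕ} (hK : K ≤ F n) :
    (constantExtension F K n).toSubfield = (F n).toSubfield := by
  have h : constantExtension F K n ≤ extendScalars hK := adjoin_le_iff.2 subset_rfl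
  exact le_antisymm h (coe_subset_constantExtension K n)

/-- The degree of `F n` over `F 0` does not drop when the constant field is enlarged, so a constant
field contained in `F n` is contained in `F 0`. -/
theorem IsKummerRecursive.le_zero_of_isAlgebraic (hF : IsKummerRecursive m b₁ b₂ F x)
    (hm : 2 ≤ m) (hcop : IsCoprime b₁ b₂) {r : ℤ} (hb₁ : b₁.natDegree = m)
    (hb₂ : (b₂.natDegree : ℤ) = m - r) (hr : Int.gcd m r = 1) (n : ℕ) (K : IntermediateField k Ω)
    [Algebra.IsAlgebraic k K] (hK : K ≤ F n) : K ≤ F 0 := by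
  have hdeg : (F 0).toSubfield.relfinrank (F n).toSubfield = m ^ n :=
    hF.relfinrank_zero hm hcop hb₁ hb₂ hr n
  have hcop' : IsCoprime (b₁.map (algebraMap k K)) (b₂.map (algebraMap k K)) :=
    hcop.map (mapRingHom (algebraMap k K))
  have hdeg₁ := (hF.constantExtension K).relfinrank_zero hm hcop' (r := r)
    ((natDegree_map _).trans hb₁) (by rwa [natDegree_map]) hr n
  have hdeg' : (FunctionFieldSeq.constantExtension F K 0).toSubfield.relfinrank
      (FunctionFieldSeq.constantExtension F K n).toSubfield = m ^ n := hdeg₁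
  have h₀ : (F 0).toSubfield ≤ (FunctionFieldSeq.constantExtension F K 0).toSubfield :=
    coe_subset_constantExtension K 0
  have h₀n : (FunctionFieldSeq.constantExtension F K 0).toSubfield ≤
      (FunctionFieldSeq.constantExtension F K n).toSubfield :=
    (FunctionFieldSeq.constantExtension F K).monotone (Nat.zero_le n)
  have hmul := Subfield.relfinrank_mul_relfinrank h₀ h₀n
  rw [hdeg', constantExtension_toSubfield hK, hdeg] at hmul
  have hone := Nat.eq_of_mul_eq_mul_right (pow_pos (by omega : 0 < m) n)
    (hmul.trans (one_mul _).symm)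
  intro z hz
  exact Subfield.relfinrank_eq_one_iff.1 hone
    (IntermediateField.algebraMap_mem (FunctionFieldSeq.constantExtension F K 0) (⟨z, hz⟩ : K))

theorem IsKummerRecursive.mem_range_of_isAlgebraic (hF : IsKummerRecursive m b₁ b₂ F x)
    (hm : 2 ≤ m) (hcop : IsCoprime b₁ b₂) {r : ℤ} (hb₁ : b₁.natDegree = m)
    (hb₂ : (b₂.natDegree : ℤ) = m - r) (hr : Int.gcd m r = 1) (n : ℕ) (z : F n)
    (hz : IsAlgebraic k z) : z ∈ (algebraMap k (F n)).range := by
  have hz' : IsAlgebraic k (z : Ω) := hz.algHom (F n).val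
  have : Algebra.IsAlgebraic k k⟮(z : Ω)⟯ := isAlgebraic_adjoin_simple hz'.isIntegral
  have hz0 : (z : Ω) ∈ F 0 := hF.le_zero_of_isAlgebraic hm hcop hb₁ hb₂ hr n k⟮(z : Ω)⟯
    (adjoin_simple_le_iff.2 z.2) (mem_adjoin_simple_self k _)
  obtain ⟨c, hc⟩ := mem_range_of_isAlgebraic_of_mem_adjoin
    (hF.transcendental_coe hcop (by omega) (ne_zero_of_natDegree_eq_sub hm hb₂ hr) 0)
    (hF.zero.le hz0) hz'
  exact ⟨c, Subtype.ext hc⟩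

theorem natCast_ne_zero_of_card_modEq [Finite k] (hq : Nat.card k ≡ 1 [MOD m]) :
    (m : k) ≠ 0 := by
  intro h
  have := Fintype.ofFinite k
  obtain ⟨t, ht⟩ := (Nat.modEq_iff_dvd' (Nat.card_pos (α := k))).1 hq.symm
  have hcard : (Nat.card k : k) = 0 := by
    rw [Nat.card_eq_fintype_card, FiniteField.cast_card_eq_zero]
  have : Nat.card k = m * t + 1 := by
    have := Nat.card_pos (α := k)
    omega
  rw [this] at hcard
  simp [h] at hcard

theorem IsKummerRecursive.finiteDimensional_adjoin_zero (hF : IsKummerRecursive m b₁ b₂ F x)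
    (hm : 0 < m) (n : ℕ) :
    FiniteDimensional k⟮incl F (Nat.zero_le n) (x 0)⟯ (F n) := by
  refine FiniteDimensional.of_finrank_pos ?_
  rw [← relfinrank_top_right, ← relfinrank_map_map _ _ (F n).val]
  have h₁ : (k⟮incl F (Nat.zero_le n) (x 0)⟯).map (F n).val = F 0 := by
    rw [adjoin_map, Set.image_singleton]
    exact hF.zero.symm
  have h₂ : (⊤ : IntermediateField k (F n)).map (F n).val = F n := by
    rw [← AlgHom.fieldRange_eq_map, fieldRange_val]
  rw [h₁, h₂]
  exact hF.relfinrank_zero_pos hm n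

theorem IsKummerRecursive.isAdmissible (hF : IsKummerRecursive m b₁ b₂ F x)
    (hm : 2 ≤ m) (hmk : (m : k) ≠ 0) (hcop : IsCoprime b₁ b₂) {r : ℤ} (hb₁ : b₁.natDegree = m)
    (hb₂ : (b₂.natDegree : ℤ) = m - r) (hr : Int.gcd m r = 1) : IsAdmissible F where
  functionField n := by
    refine ⟨incl F (Nat.zero_le n) (x 0), fun h ↦ hF.transcendental ?_,
      hF.finiteDimensional_adjoin_zero (by omega) n⟩
    exact (isAlgebraic_algHom_iff (incl F (Nat.zero_le n)) (RingHom.injective _)).1 h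
  ssubset i := by
    refine lt_of_le_of_ne (F.monotone (Nat.le_succ i)) fun h ↦ ?_
    have := hF.relfinrank_succ hm hcop hb₁ hb₂ hr i
    rw [← h, relfinrank_self] at this
    omega
  finite i := by
    have := hF.relfinrank_succ_pos (by omega) i
    rw [relfinrank_eq_finrank_of_le (F.monotone (Nat.le_succ i))] at this
    exact FiniteDimensional.of_finrank_pos this
  separable i := by
    have hsep : IsSeparable (F i) (x (i + 1) : Ω) := by
      have hx0 : (x (i + 1) : Ω) ^ m ≠ 0 := pow_ne_zero _ <| ne_zero_of_transcendental <|
        hF.transcendental_coe hcop (by omega) (ne_zero_of_natDegree_eq_sub hm hb₂ hr) (i + 1)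
      let a : F i := ⟨(x (i + 1) : Ω) ^ m, hF.adjoin_le i (hF.pow_mem i)⟩
      have ha : a ≠ 0 := fun h ↦ hx0 (congrArg Subtype.val h)
      have hmF : (m : F i) ≠ 0 := by
        rw [← map_natCast (algebraMap k (F i))]
        exact (_root_.map_ne_zero _).2 hmk
      refine (separable_X_pow_sub_C a hmF ha).of_dvd (minpoly.dvd _ _ ?_)
      simp [a, IntermediateField.algebraMap_apply]
    have h := (isSeparable_adjoin_simple_iff_isSeparable (F := F i) (E := Ω)).2 hsep
    have key : ∀ G : IntermediateField k Ω, (h' : F i ≤ G) →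
        G = ((F i)⟮(x (i + 1) : Ω)⟯).restrictScalars k →
        Algebra.IsSeparable (F i) (extendScalars h') := by
      rintro G h' rfl
      exact h
    exact key _ _ (hF.succ i)
  constants i z hz := hF.mem_range_of_isAlgebraic hm hcop hb₁ hb₂ hr i z hz

end Admissible

/-! ### Valuation rings of function fields of one variable -/

section FunctionField

open scoped IntermediateField.algebraAdjoinAdjoin

variable {k E : Type*} [Field k] [Field E] [Algebra k E]

theorem mem_of_isIntegralElem (A : ValuationSubring E) {R : Type*} [CommRing R] (φ : R →+* E) (hφ : ∀ s, φ s ∈ A) {w : E}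
    (hw : φ.IsIntegralElem w) : w ∈ A := by
  obtain ⟨q, hq, hqw⟩ := hw
  have hint : IsIntegral A w := by
    refine ⟨q.map (φ.codRestrict A.toSubring hφ), hq.map _, ?_⟩
    rw [eval₂_map]
    exact hqw
  obtain ⟨b, rfl⟩ := IsIntegrallyClosed.isIntegral_iff.1 hint
  exact b.2

/-- In transcendence degree one, any transcendental element is a transcendence basis. -/
theorem isAlgebraic_adjoin_of_transcendental {t : E} [Algebra.IsAlgebraic k⟮t⟯ E] {a : E}
    (ha : Transcendental k a) : Algebra.IsAlgebraic (Algebra.adjoin k {a}) E := by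
  have ht : Algebra.IsAlgebraic (Algebra.adjoin k {t}) E :=
    Algebra.IsAlgebraic.trans (Algebra.adjoin k {t}) k⟮t⟯ E
  have hdeg : Algebra.trdeg k E ≤ 1 := by
    simpa using Algebra.IsAlgebraic.trdeg_le_cardinalMk k {t}
  have hind : AlgebraicIndependent k ((↑) : ({a} : Set E) → E) :=
    algebraicIndependent_unique_type_iff.2 ha
  have hbasis := hind.isTranscendenceBasis_of_trdeg_le_of_finite (by simpa using hdeg)
  have := hbasis.isAlgebraic
  rwa [Subtype.range_coe] at this

/-- Every `z` satisfies an equation `p(a, z) = 0`, with `p` not divisible by a nonconstant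
polynomial in its first variable. -/
theorem exists_isPrimitive_eval₂_eq_zero {t : E} [Algebra.IsAlgebraic k⟮t⟯ E] {a : E}
    (ha : Transcendental k a) (z : E) :
    ∃ p : k[X][X], p.IsPrimitive ∧ p.eval₂ (aeval a : k[X] →ₐ[k] E).toRingHom z = 0 := by
  have := isAlgebraic_adjoin_of_transcendental (t := t) ha
  obtain ⟨q, hq, hqz⟩ := Algebra.IsAlgebraic.isAlgebraic (R := Algebra.adjoin k {a}) z
  let e := algEquivOfTranscendental k a ha
  let p : k[X][X] := q.map e.symm.toRingEquiv.toRingHom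
  have hp : p ≠ 0 := (Polynomial.map_ne_zero_iff e.symm.injective).2 hq
  have hpz : p.eval₂ (aeval a : k[X] →ₐ[k] E).toRingHom z = 0 := by
    have hcomp : (aeval a : k[X] →ₐ[k] E).toRingHom.comp e.symm.toRingEquiv.toRingHom =
        algebraMap (Algebra.adjoin k {a}) E := by
      ext b
      obtain ⟨s, rfl⟩ := e.surjective b
      change aeval a (e.symm (e s)) = (e s : E)
      rw [e.symm_apply_apply]
      simp [e, algEquivOfTranscendental_apply]
    rw [eval₂_map, hcomp]
    exact hqz
  let _ : NormalizedGCDMonoid k[X] := Classical.choice inferInstance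
  refine ⟨p.primPart, p.isPrimitive_primPart, ?_⟩
  rw [p.eq_C_content_mul_primPart, eval₂_mul, eval₂_C, mul_eq_zero] at hpz
  refine hpz.resolve_left fun h ↦ hp ?_
  exact content_eq_zero_iff.1 (transcendental_iff.1 ha _ h)

variable (A : ValuationSubring E) (hA : ∀ c : k, algebraMap k E c ∈ A)
include hA

/-- The maximal ideal of a valuation ring containing `k` has no nonzero algebraic elements. -/
theorem transcendental_of_valuation_lt_one {a : E} (ha0 : a ≠ 0) (ha : A.valuation a < 1) :
    Transcendental k a := by
  intro halg
  have hv : 1 < A.valuation a⁻¹ := by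
    rw [map_inv₀]
    exact (one_lt_inv₀ (zero_lt_iff.2 (by simpa using ha0))).2 ha
  obtain ⟨p, hp, hpa⟩ := halg.inv
  have := valuation_aeval A.valuation (fun c ↦ valuation_algebraMap_eq_one A hA) hv hp
  rw [hpa, map_zero] at this
  exact pow_ne_zero _ (zero_lt_one.trans hv).ne' this.symm

theorem pow_natDegree_le_valuation_aeval {a : E} (ha0 : a ≠ 0) (ha : A.valuation a < 1) {q : k[X]}
    (hq : q ≠ 0) : A.valuation a ^ q.natDegree ≤ A.valuation (aeval a q) := by
  have hva : A.valuation a ≠ 0 := (Valuation.ne_zero_iff _).2 ha0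
  have hv : 1 < A.valuation a⁻¹ := by
    rw [map_inv₀]
    exact (one_lt_inv₀ (zero_lt_iff.2 hva)).2 ha
  have hrev : aeval a q = aeval a⁻¹ q.reverse * a ^ q.natDegree := by
    have := invertibleOfNonzero ha0
    have h := eval₂_reverse_mul_pow (algebraMap k E) a q
    rw [invOf_eq_inv] at h
    exact h.symm
  rw [hrev, map_mul, map_pow, valuation_aeval A.valuation
    (fun c ↦ valuation_algebraMap_eq_one A hA) hv (by simpa using hq)]
  exact le_mul_of_one_le_left' (one_le_pow₀ hv.le)

/-- The places of a function field of one variable have archimedean value groups. -/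
theorem exists_pow_mul_valuation_le_one {t : E} [Algebra.IsAlgebraic k⟮t⟯ E] {a : E}
    (ha : A.valuation a < 1) (z : E) : ∃ N : ℕ, A.valuation a ^ N * A.valuation z ≤ 1 := by
  by_cases ha0 : a = 0
  · exact ⟨1, by simp [ha0]⟩
  obtain ⟨p, hp, hpz⟩ := exists_isPrimitive_eval₂_eq_zero (t := t)
    (transcendental_of_valuation_lt_one A hA ha0 ha) z
  -- the leading coefficient `q(a)` of the equation of `z` makes `q(a) * z` integral, and is bounded
  -- below by the power `deg q` of `v(a)`
  have hint := RingHom.isIntegralElem_leadingCoeff_mul _ p z hpz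
  have hmem : aeval a p.leadingCoeff * z ∈ A := by
    refine mem_of_isIntegralElem A _ (fun s ↦ ?_) hint
    change aeval a s ∈ A
    rw [aeval_eq_sum_range]
    refine sum_mem fun i _ ↦ ?_
    rw [Algebra.smul_def]
    exact mul_mem (hA _) (pow_mem ((A.valuation_le_one_iff _).1 ha.le) _)
  refine ⟨p.leadingCoeff.natDegree, ?_⟩
  rw [← A.valuation_le_one_iff, map_mul] at hmem
  exact (mul_le_mul_left (pow_natDegree_le_valuation_aeval A hA ha0 ha
    (leadingCoeff_ne_zero.2 hp.ne_zero)) _).trans hmem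

end FunctionField

/-! ### Approximation for the conjugates of a valuation -/

section Approximation

variable {E Γ : Type*} [Field E] [LinearOrderedCommGroupWithZero Γ]

theorem valuation_geom_sum_mul_lt_one (w : Valuation E Γ) {x : E} (hx : w x ≤ 1) {d : ℕ}
    (hd : w (∑ i ∈ Finset.range d, x ^ i) < 1) (e : ℕ) :
    w (∑ i ∈ Finset.range (d * e), x ^ i) < 1 := by
  induction e with
  | zero => simp
  | succ e ih =>
    rw [mul_add_one, Finset.sum_range_add]
    refine w.map_add_lt ih ?_
    simp only [pow_add, ← Finset.mul_sum]
    rw [map_mul, map_pow]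
    exact (mul_le_of_le_one_left' (pow_le_one₀ zero_le hx)).trans_lt hd

theorem one_lt_valuation_geom_sum (w : Valuation E Γ) {x : E} (hx : 1 < w x) {N : ℕ} (hN : N ≠ 0) :
    1 < w (∑ i ∈ Finset.range (N + 1), x ^ i) := by
  rw [w.map_sum_eq_of_lt (j := N) (by simp), map_pow]
  · exact one_lt_pow₀ hx hN
  · intro i hi
    simp only [Finset.mem_sdiff, Finset.mem_range, Finset.mem_singleton] at hi
    rw [map_pow, map_pow]
    exact pow_lt_pow_right₀ hx (by omega)

/-- Given finitely many valuations, an element `x` can be traded for an element `c` which is integral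
at all of them, is a unit where `x` is integral, and is a nonunit where `x` has a pole. The
element is `c = 1 / (1 + x + ⋯ + x ^ N)`, for an `N` chosen so that the denominator is a unit
wherever `x` is integral. -/
theorem exists_valuation_lt_one_of_pole {ι : Type*} [Finite ι] (w : ι → Valuation E Γ) (x : E) :
    ∃ c : E, ∀ i, w i c ≤ 1 ∧ (w i x ≤ 1 → w i c = 1) ∧ (1 < w i x → w i c < 1) := by
  classical
  have := Fintype.ofFinite ι
  have hex : ∀ i, ∃ d : ℕ, d ≠ 0 ∧ ((∃ e ≠ 0, w i (∑ j ∈ Finset.range e, x ^ j) < 1) →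
      w i (∑ j ∈ Finset.range d, x ^ j) < 1) := by
    intro i
    by_cases h : ∃ e ≠ 0, w i (∑ j ∈ Finset.range e, x ^ j) < 1
    · obtain ⟨e, he, hlt⟩ := h
      exact ⟨e, he, fun _ ↦ hlt⟩
    · exact ⟨1, one_ne_zero, fun h' ↦ absurd h' h⟩
  choose d hd0 hd using hex
  let N := ∏ i, d i
  have hN : N ≠ 0 := Finset.prod_ne_zero_iff.2 fun i _ ↦ hd0 i
  have hunit : ∀ i, w i x ≤ 1 → w i (∑ j ∈ Finset.range (N + 1), x ^ j) = 1 := by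
    intro i hi
    by_cases h : ∃ e ≠ 0, w i (∑ j ∈ Finset.range e, x ^ j) < 1
    · obtain ⟨e, he⟩ : d i ∣ N := Finset.dvd_prod_of_mem d (Finset.mem_univ i)
      have hlt := valuation_geom_sum_mul_lt_one (w i) hi (hd i h) e
      rw [← he] at hlt
      rw [Finset.sum_range_succ', add_comm, pow_zero]
      refine (w i).map_one_add_of_lt ?_
      simp only [pow_succ, ← Finset.sum_mul]
      rw [map_mul]
      exact (mul_le_of_le_one_right' hi).trans_lt hlt
    · push Not at h
      refine le_antisymm ((w i).map_sum_le fun j _ ↦ ?_) (h _ (Nat.succ_ne_zero _))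
      rw [map_pow]
      exact pow_le_one₀ zero_le hi
  refine ⟨(∑ j ∈ Finset.range (N + 1), x ^ j)⁻¹, fun i ↦ ?_⟩
  rw [map_inv₀]
  rcases le_or_gt (w i x) 1 with hi | hi
  · rw [hunit i hi]
    exact ⟨by simp, fun _ ↦ inv_one, fun h ↦ absurd hi h.not_ge⟩
  · have hlt := inv_lt_one_of_one_lt₀ (one_lt_valuation_geom_sum (w i) hi hN)
    exact ⟨hlt.le, fun h ↦ absurd hi h.not_gt, fun _ ↦ hlt⟩

variable {G : Type*} [Group G] [Finite G] [MulSemiringAction G E]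

/-- If `g` maps the valuation ring into itself then it preserves the valuation, as its order is
finite. -/
theorem valuation_smul_le_of_forall (v : Valuation E Γ) {g : G}
    (hg : ∀ x, v x ≤ 1 → v (g • x) ≤ 1) {z : E} (hz : z ≠ 0) : v (g • z) ≤ v z := by
  by_contra! hlt
  have hmono : ∀ x y : E, y ≠ 0 → v x ≤ v y → v (g • x) ≤ v (g • y) := by
    intro x y hy hxy
    have hvy : 0 < v y := zero_lt_iff.2 (v.ne_zero_iff.2 hy)
    have hvgy : 0 < v (g • y) := zero_lt_iff.2 (v.ne_zero_iff.2 ((smul_ne_zero_iff_ne g).2 hy))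
    have h := hg (x / y) (by rw [map_div₀]; exact (div_le_one₀ hvy).2 hxy)
    rw [smul_div₀', map_div₀] at h
    exact (div_le_one₀ hvgy).1 h
  have hpow : ∀ n : ℕ, v z < v (g ^ (n + 1) • z) := by
    intro n
    induction n with
    | zero => simpa using hlt
    | succ n ih =>
      rw [pow_succ', mul_smul]
      exact hlt.trans_le (hmono _ _ ((smul_ne_zero_iff_ne _).2 hz) ih.le)
  have := hpow (orderOf g - 1)
  rw [Nat.sub_add_cancel (orderOf_pos g), pow_orderOf_eq_one, one_smul] at this
  exact lt_irrefl _ this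

/-- Every value of an archimedean valuation is attained at an element `z'` whose conjugates have
no larger values. -/
theorem exists_valuation_smul_le (v : Valuation E Γ)
    (harch : ∀ a z : E, v a < 1 → ∃ N : ℕ, v a ^ N * v z ≤ 1) {z : E} (hz : z ≠ 0) :
    ∃ z' : E, v z' = v z ∧ ∀ g : G, v (g • z') ≤ v z := by
  classical
  have := Fintype.ofFinite G
  -- `c g` is a unit which becomes a nonunit under `g`, if `g` moves the valuation ring
  have hex : ∀ g : G, ∃ c : E, v c = 1 ∧ (∀ h : G, v (h • c) ≤ 1) ∧
      ((∃ x, v x ≤ 1 ∧ 1 < v (g • x)) → v (g • c) < 1) := by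
    intro g
    by_cases h : ∃ x, v x ≤ 1 ∧ 1 < v (g • x)
    · obtain ⟨x, hx, hgx⟩ := h
      obtain ⟨c, hc⟩ := exists_valuation_lt_one_of_pole
        (fun h : G ↦ v.comap (MulSemiringAction.toRingHom G E h)) x
      simp only [Valuation.comap_apply, MulSemiringAction.toRingHom_apply] at hc
      refine ⟨c, ?_, fun h ↦ (hc h).1, fun _ ↦ (hc g).2.2 hgx⟩
      have := (hc 1).2.1
      rw [one_smul, one_smul] at this
      exact this hx
    · exact ⟨1, map_one v, fun h ↦ by rw [smul_one, map_one], fun h' ↦ absurd h' h⟩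
  choose c hc1 hcle hclt using hex
  let C := ∏ g, c g
  have hC1 : v C = 1 := by
    rw [map_prod]
    exact Finset.prod_eq_one fun g _ ↦ hc1 g
  have hCle : ∀ h : G, v (h • C) ≤ 1 := by
    intro h
    rw [Finset.smul_prod', map_prod]
    exact Finset.prod_le_one' fun g _ ↦ hcle g h
  have hClt : ∀ g : G, (∃ x, v x ≤ 1 ∧ 1 < v (g • x)) → v (g • C) < 1 := by
    intro g hg
    rw [Finset.smul_prod', map_prod, ← Finset.mul_prod_erase _ _ (Finset.mem_univ g)]
    exact (mul_le_of_le_one_right' (Finset.prod_le_one' fun g' _ ↦ hcle g' g)).trans_lt (hclt g hg)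
  have hvz : v z ≠ 0 := v.ne_zero_iff.2 hz
  have hN : ∀ g : G, ∃ N : ℕ, ∀ M, N ≤ M → v (g • C) ^ M * v (g • z) ≤ v z := by
    intro g
    by_cases h : ∃ x, v x ≤ 1 ∧ 1 < v (g • x)
    · obtain ⟨N, hN⟩ := harch (g • C) (g • z / z) (hClt g h)
      refine ⟨N, fun M hM ↦ ?_⟩
      rw [map_div₀, ← mul_div_assoc, div_le_one₀ (zero_lt_iff.2 hvz)] at hN
      exact (mul_le_mul_left (pow_le_pow_right_of_le_one' (hCle g) hM) _).trans hN
    · push Not at h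
      exact ⟨0, fun M _ ↦ (mul_le_of_le_one_left' (pow_le_one₀ zero_le (hCle g))).trans
        (valuation_smul_le_of_forall v h hz)⟩
  choose N hN using hN
  refine ⟨C ^ (∑ g, N g) * z, by rw [map_mul, map_pow, hC1, one_pow, one_mul], fun g ↦ ?_⟩
  rw [smul_mul', smul_pow', map_mul, map_pow]
  exact hN g _ (Finset.single_le_sum (fun _ _ ↦ Nat.zero_le _) (Finset.mem_univ g))

end Approximation

/-! ### Value groups in Kummer extensions -/

section KummerStep

variable {F E Γ : Type*} [Field F] [Field E] [Algebra F E] [LinearOrderedCommGroupWithZero Γ]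
  {ζ : F}

theorem exists_algEquiv_apply_gen_eq_mul (pb : PowerBasis F E) (hζ : ζ ^ pb.dim = 1)
    {a : F} (ha : pb.gen ^ pb.dim = algebraMap F E a) :
    ∃ σ : E ≃ₐ[F] E, σ pb.gen = algebraMap F E ζ * pb.gen := by
  have := pb.finite
  have hmin : minpoly F pb.gen = X ^ pb.dim - C a := by
    refine (eq_of_monic_of_dvd_of_natDegree_le (minpoly.monic pb.isIntegral_gen)
      (monic_X_pow_sub_C a pb.dim_ne_zero) (minpoly.dvd _ _ (by simp [ha])) ?_).symm
    rw [natDegree_X_pow_sub_C, pb.natDegree_minpoly]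
  have hroot : aeval (algebraMap F E ζ * pb.gen) (minpoly F pb.gen) = 0 := by
    rw [hmin, map_sub, map_pow, aeval_X, aeval_C, mul_pow, ← map_pow, hζ, map_one, one_mul, ha,
      sub_self]
  exact ⟨AlgEquiv.ofBijective _ (pb.lift _ hroot).bijective, pb.lift_gen _ hroot⟩

/-- The components of `z = ∑ c l * y ^ l` are recovered from its conjugates by the orthogonality
of the characters of the cyclic group generated by `y ↦ ζ * y`. -/
theorem sum_mul_conjugates_eq {m : ℕ} {y : E} (hζ : IsPrimitiveRoot ζ m) (σ : E ≃ₐ[F] E)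
    (hσ : σ y = algebraMap F E ζ * y) (c : Fin m → F) (i : Fin m) :
    ∑ j ∈ Finset.range m, algebraMap F E (ζ⁻¹ ^ (i : ℕ)) ^ j *
      (σ ^ j) (∑ l, algebraMap F E (c l) * y ^ (l : ℕ)) =
    (m : E) * (algebraMap F E (c i) * y ^ (i : ℕ)) := by
  have hm : m ≠ 0 := by
    rintro rfl
    exact i.elim0
  have hζ0 : ζ ≠ 0 := hζ.ne_zero hm
  have hσj : ∀ j : ℕ, (σ ^ j) y = algebraMap F E ζ ^ j * y := by
    intro j
    induction j with
    | zero => simp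
    | succ j ih => rw [pow_succ', AlgEquiv.mul_apply, ih, map_mul, map_pow, σ.commutes, hσ]; ring
  have hterm : ∀ j : ℕ, algebraMap F E (ζ⁻¹ ^ (i : ℕ)) ^ j *
      (σ ^ j) (∑ l, algebraMap F E (c l) * y ^ (l : ℕ)) =
      ∑ l : Fin m, algebraMap F E ((ζ⁻¹ ^ (i : ℕ) * ζ ^ (l : ℕ)) ^ j) *
        (algebraMap F E (c l) * y ^ (l : ℕ)) := by
    intro j
    rw [map_sum, Finset.mul_sum]
    refine Finset.sum_congr rfl fun l _ ↦ ?_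
    rw [map_mul, AlgEquiv.commutes, map_pow (σ ^ j), hσj]
    simp only [map_mul, map_pow, mul_pow]
    ring
  simp only [hterm]
  rw [Finset.sum_comm]
  simp only [← Finset.sum_mul, ← map_sum]
  rw [Finset.sum_eq_single i]
  · rw [← mul_pow, inv_mul_cancel₀ hζ0]
    simp
  · intro l _ hl
    have hne : ζ⁻¹ ^ (i : ℕ) * ζ ^ (l : ℕ) ≠ 1 := by
      intro h
      rw [inv_pow, inv_mul_eq_one₀ (pow_ne_zero _ hζ0)] at h
      exact hl (Fin.ext (hζ.pow_inj l.2 i.2 h.symm))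
    have hpow : (ζ⁻¹ ^ (i : ℕ) * ζ ^ (l : ℕ)) ^ m = 1 := by
      rw [mul_pow, ← pow_mul, ← pow_mul, mul_comm _ m, mul_comm _ m, pow_mul, pow_mul, inv_pow,
        hζ.pow_eq_one]
      simp
    have hgeom := mul_neg_geom_sum (ζ⁻¹ ^ (i : ℕ) * ζ ^ (l : ℕ)) m
    rw [hpow, sub_self, mul_eq_zero, sub_eq_zero] at hgeom
    rw [hgeom.resolve_left hne.symm, map_zero, zero_mul]
  · simp

/-- In a Kummer extension `E = F(y)` of degree prime to the residue characteristic, the value group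
of `E` is generated by the value group of `F` and the value of `y`. -/
theorem exists_valuation_eq_mul_pow (v : Valuation E Γ)
    (harch : ∀ a z : E, v a < 1 → ∃ N : ℕ, v a ^ N * v z ≤ 1) (pb : PowerBasis F E)
    (hv : v (pb.dim : E) = 1) (hζ : IsPrimitiveRoot ζ pb.dim) {a : F}
    (ha : pb.gen ^ pb.dim = algebraMap F E a) {z : E} (hz : z ≠ 0) :
    ∃ (c : F) (i : ℕ), v z = v (algebraMap F E c * pb.gen ^ i) := by
  have := pb.finite
  obtain ⟨σ, hσ⟩ := exists_algEquiv_apply_gen_eq_mul pb hζ.pow_eq_one ha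
  obtain ⟨z', hz', hle⟩ := exists_valuation_smul_le (G := E ≃ₐ[F] E) v harch hz
  have hvζ : v (algebraMap F E ζ) = 1 := by
    rw [← pow_eq_one_iff_of_nonneg zero_le pb.dim_ne_zero, ← map_pow, ← map_pow,
      hζ.pow_eq_one, map_one, map_one]
  have hsum : z' = ∑ l, algebraMap F E (pb.basis.repr z' l) * pb.gen ^ (l : ℕ) := by
    conv_lhs => rw [← pb.basis.sum_repr z']
    simp [Algebra.smul_def]
  have hcomp : ∀ i, v (algebraMap F E (pb.basis.repr z' i) * pb.gen ^ (i : ℕ)) ≤ v z := by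
    intro i
    have h := sum_mul_conjugates_eq hζ σ hσ (fun l ↦ pb.basis.repr z' l) i
    rw [← hsum] at h
    rw [← one_mul (v _), ← hv, ← map_mul, ← h]
    refine v.map_sum_le fun j _ ↦ ?_
    rw [map_mul, map_pow, map_pow, map_pow, map_inv₀, map_inv₀, hvζ, inv_one, one_pow, one_pow,
      one_mul]
    exact hle (σ ^ j)
  by_contra! hne
  have hlt : v (∑ l, algebraMap F E (pb.basis.repr z' l) * pb.gen ^ (l : ℕ)) < v z :=
    v.map_sum_lt (v.ne_zero_iff.2 hz) fun l _ ↦ lt_of_le_of_ne (hcomp l) (hne _ _).symm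
  rw [← hsum, hz'] at hlt
  exact lt_irrefl _ hlt

end KummerStep

/-! ### The ramification index -/

section RamificationIndex

variable {F E E' : Type*} [Field F] [Field E] [Field E']

/-- The subgroup `Fˣ · 𝒪ˣ` of `Eˣ`, for a valuation ring `𝒪` of the extension field `E` of `F`. Its
index is the ramification index. -/
noncomputable def unitsSup (f : F →+* E) (A : ValuationSubring E) : Subgroup Eˣ :=
  (Units.map (f : F →* E)).range ⊔ A.unitGroup

theorem mem_unitsSup {f : F →+* E} {A : ValuationSubring E} {u : Eˣ} :
    u ∈ unitsSup f A ↔ ∃ a : Fˣ, A.valuation u = A.valuation (f a) := by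
  rw [unitsSup, Subgroup.mem_sup]
  constructor
  · rintro ⟨_, ⟨a, rfl⟩, w, hw, rfl⟩
    refine ⟨a, ?_⟩
    rw [Units.val_mul, map_mul, (A.mem_unitGroup_iff w).1 hw, mul_one]
    rfl
  · rintro ⟨a, ha⟩
    refine ⟨_, ⟨a, rfl⟩, (Units.map (f : F →* E) a)⁻¹ * u, ?_, mul_inv_cancel_left _ _⟩
    rw [A.mem_unitGroup_iff, Units.val_mul, map_mul, ha, Units.val_inv_eq_inv_val, map_inv₀]
    exact inv_mul_cancel₀ ((Valuation.ne_zero_iff _).2 (by simp))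

theorem valuation_comap_eq_iff (g : E →+* E') (A : ValuationSubring E') (x y : E) :
    (A.comap g).valuation x = (A.comap g).valuation y ↔
      A.valuation (g x) = A.valuation (g y) := by
  have h : ((A.comap g).valuation).IsEquiv (A.valuation.comap g) := by
    rw [Valuation.isEquiv_iff_valuationSubring, ValuationSubring.valuationSubring_valuation]
    ext z
    rw [Valuation.mem_valuationSubring_iff, Valuation.comap_apply, A.valuation_le_one_iff]
    rfl
  exact h.eq_iff

/-- The ramification index is multiplicative in towers. -/
theorem index_unitsSup_comp (f : F →+* E) (g : E →+* E') (A : ValuationSubring E') :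
    (unitsSup (g.comp f) A).index =
      (unitsSup f (A.comap g)).index * (unitsSup g A).index := by
  have hle : unitsSup (g.comp f) A ≤ unitsSup g A := by
    intro u hu
    obtain ⟨a, ha⟩ := mem_unitsSup.1 hu
    exact mem_unitsSup.2 ⟨Units.map (f : F →* E) a, ha⟩
  have hsup : unitsSup g A = (Units.map (g : E →* E')).range ⊔ unitsSup (g.comp f) A := by
    refine le_antisymm (sup_le le_sup_left (le_sup_of_le_right le_sup_right))
      (sup_le le_sup_left hle)
  have hcomap : (unitsSup (g.comp f) A).comap (Units.map (g : E →* E')) =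
      unitsSup f (A.comap g) := by
    ext u
    rw [Subgroup.mem_comap, mem_unitsSup, mem_unitsSup]
    simp only [valuation_comap_eq_iff]
    rfl
  rw [← Subgroup.relIndex_mul_index hle, ← hcomap, Subgroup.index_comap]
  congr 1
  conv_lhs => rw [hsup]
  exact Subgroup.relIndex_sup_right ..

/-- If the values of `E` are generated by those of `F` and the value of an `m`-th root `y` of an
element of `F`, then `Eˣ / Fˣ · 𝒪ˣ` is cyclic, generated by `y`, of order dividing `m`. -/
theorem index_unitsSup_dvd (f : F →+* E) (A : ValuationSubring E) {m : ℕ} {y : E} {a : F}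
    (hy0 : y ≠ 0) (ha : y ^ m = f a)
    (h : ∀ z ≠ 0, ∃ (c : F) (i : ℕ), A.valuation z = A.valuation (f c * y ^ i)) :
    (unitsSup f A).index ∣ m ∧ (A.valuation y = 1 → (unitsSup f A).index = 1) := by
  have hc0 : ∀ (z : E) (c : F) (i : ℕ), z ≠ 0 → A.valuation z = A.valuation (f c * y ^ i) →
      c ≠ 0 := by
    rintro z c i hz hzc rfl
    rw [map_zero, zero_mul, map_zero, map_eq_zero] at hzc
    exact hz hzc
  constructor
  · have hgen : ∀ q : Eˣ ⧸ unitsSup f A,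
        q ∈ Subgroup.zpowers (QuotientGroup.mk (Units.mk0 y hy0) : Eˣ ⧸ unitsSup f A) := by
      intro q
      induction q using QuotientGroup.induction_on with
      | H u =>
        obtain ⟨c, i, hci⟩ := h u u.ne_zero
        refine ⟨i, ?_⟩
        change (QuotientGroup.mk (Units.mk0 y hy0) : Eˣ ⧸ unitsSup f A) ^ (i : ℤ) = _
        rw [zpow_natCast, ← QuotientGroup.mk_pow, QuotientGroup.eq]
        refine mem_unitsSup.2 ⟨Units.mk0 c (hc0 _ _ _ u.ne_zero hci), ?_⟩
        have hvy : A.valuation y ≠ 0 := (Valuation.ne_zero_iff _).2 hy0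
        simp only [Units.val_mul, Units.val_inv_eq_inv_val, Units.val_pow_eq_pow_val, Units.val_mk0,
          map_mul, map_inv₀, map_pow, hci]
        rw [mul_left_comm, inv_mul_cancel₀ (pow_ne_zero _ hvy), mul_one]
    rw [Subgroup.index, ← orderOf_eq_card_of_forall_mem_zpowers hgen]
    refine orderOf_dvd_of_pow_eq_one ?_
    rw [← QuotientGroup.mk_pow, QuotientGroup.eq_one_iff]
    have ha0 : a ≠ 0 := by
      rintro rfl
      rw [map_zero] at ha
      exact pow_ne_zero m hy0 ha
    exact mem_unitsSup.2 ⟨Units.mk0 a ha0, by simp [← ha]⟩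
  · intro hy
    rw [Subgroup.index_eq_one, eq_top_iff]
    intro u _
    obtain ⟨c, i, hci⟩ := h u u.ne_zero
    exact mem_unitsSup.2 ⟨Units.mk0 c (hc0 _ _ _ u.ne_zero hci), by simp [hci, hy]⟩

end RamificationIndex

/-! ### Ramification in the sequence -/

section Tower

variable {k Ω : Type*} [Field k] [Field Ω] [Algebra k Ω] {m : ℕ} {b₁ b₂ : k[X]}
  {F : ℕ →o IntermediateField k Ω} {x : (i : ℕ) → F i}

theorem exists_isPrimitiveRoot_of_card_modEq [Finite k] (hq : Nat.card k ≡ 1 [MOD m]) :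
    ∃ ζ : k, IsPrimitiveRoot ζ m := by
  have hdvd : m ∣ Nat.card kˣ := by
    rw [Nat.card_units]
    exact (Nat.modEq_iff_dvd' (Nat.card_pos (α := k))).1 hq.symm
  obtain ⟨g, hg⟩ := IsCyclic.exists_ofOrder_eq_natCard (α := kˣ)
  obtain ⟨e, he⟩ := hdvd
  have hpos : 0 < Nat.card kˣ := Nat.card_pos
  have hroot : IsPrimitiveRoot (g : k) (Nat.card kˣ) := by
    rw [IsPrimitiveRoot.coe_units_iff, ← hg]
    exact IsPrimitiveRoot.orderOf g
  exact ⟨_, hroot.pow hpos (he.trans (mul_comm _ _))⟩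

theorem IsKummerRecursive.exists_powerBasis (hF : IsKummerRecursive m b₁ b₂ F x) (n : ℕ)
    (hm : 0 < m) (hdeg : relfinrank (F n) (F (n + 1)) = m) :
    letI := (incl F (Nat.le_succ n)).toRingHom.toAlgebra
    ∃ pb : PowerBasis (F n) (F (n + 1)), pb.gen = x (n + 1) ∧ pb.dim = m := by
  let := (incl F (Nat.le_succ n)).toRingHom.toAlgebra
  have hint := hF.isIntegral hm n
  have hle : F (n + 1) ≤ _ := (hF.succ n).le
  have hge : _ ≤ F (n + 1) := (hF.succ n).ge
  let e : (F n)⟮(x (n + 1) : Ω)⟯ ≃ₐ[F n] F (n + 1) :=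
    { toFun z := ⟨z, hge z.2⟩
      invFun z := ⟨z, hle z.2⟩
      left_inv _ := rfl
      right_inv _ := rfl
      map_mul' _ _ := rfl
      map_add' _ _ := rfl
      commutes' _ := rfl }
  refine ⟨(adjoin.powerBasis hint).map e, ?_, ?_⟩
  · rw [PowerBasis.map_gen, adjoin.powerBasis_gen]
    rfl
  · rw [PowerBasis.map_dim, adjoin.powerBasis_dim, ← relfinrank_adjoin_simple hint, ← hF.succ, hdeg]

/-- The ramification indices of a step of the sequence. -/
theorem IsKummerRecursive.index_unitsSup_succ (hF : IsKummerRecursive m b₁ b₂ F x) {n : ℕ}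
    (hm : 0 < m) (hmk : (m : k) ≠ 0) {ζ : k} (hζ : IsPrimitiveRoot ζ m)
    (hdeg : relfinrank (F n) (F (n + 1)) = m) (hx : (x (n + 1) : Ω) ≠ 0)
    (A : ValuationSubring (F (n + 1))) (hA : ∀ c : k, algebraMap k (F (n + 1)) c ∈ A) :
    (unitsSup (incl F (Nat.le_succ n)).toRingHom A).index ∣ m ∧
      (A.valuation (x (n + 1)) = 1 →
        (unitsSup (incl F (Nat.le_succ n)).toRingHom A).index = 1) := by
  let := (incl F (Nat.le_succ n)).toRingHom.toAlgebra
  obtain ⟨pb, hgen, hdim⟩ := hF.exists_powerBasis n hm hdeg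
  have hfin := hF.finiteDimensional_adjoin_zero hm (n + 1)
  have hx0 : x (n + 1) ≠ 0 := fun h ↦ hx (congrArg Subtype.val h)
  let a : F n := ⟨(x (n + 1) : Ω) ^ m, hF.adjoin_le n (hF.pow_mem n)⟩
  have ha : x (n + 1) ^ m = algebraMap (F n) (F (n + 1)) a := rfl
  refine index_unitsSup_dvd _ A hx0 ha fun z hz ↦ ?_
  rw [← hgen]
  refine exists_valuation_eq_mul_pow A.valuation
    (fun a z h ↦ exists_pow_mul_valuation_le_one A hA (t := incl F (Nat.zero_le (n + 1)) (x 0)) h z)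
    pb ?_
    (ζ := algebraMap k (F n) ζ) ?_ (a := a) ?_ hz
  · rw [hdim, ← map_natCast (algebraMap k (F (n + 1)))]
    exact valuation_algebraMap_eq_one A hA hmk
  · rw [hdim]
    exact hζ.map_of_injective (algebraMap k (F n)).injective
  · rw [hgen, hdim, ha]

/-- The ramification indices in `F n / F 0` divide `m ^ n`, and a place at which `x 1, …, x n` are
units is unramified. -/
theorem IsKummerRecursive.index_unitsSup_zero (hF : IsKummerRecursive m b₁ b₂ F x)
    (hm : 0 < m) (hmk : (m : k) ≠ 0) {ζ : k} (hζ : IsPrimitiveRoot ζ m)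
    (hdeg : ∀ n, relfinrank (F n) (F (n + 1)) = m) (hx : ∀ n, (x n : Ω) ≠ 0) (n : ℕ)
    (A : ValuationSubring (F n)) (hA : ∀ c : k, algebraMap k (F n) c ∈ A) :
    (unitsSup (incl F (Nat.zero_le n)).toRingHom A).index ∣ m ^ n ∧
      ((∀ i (h : i + 1 ≤ n), A.valuation (incl F h (x (i + 1))) = 1) →
        (unitsSup (incl F (Nat.zero_le n)).toRingHom A).index = 1) := by
  induction n with
  | zero =>
    have h : (unitsSup (incl F (Nat.zero_le 0)).toRingHom A).index = 1 := by
      rw [Subgroup.index_eq_one, eq_top_iff]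
      exact fun u _ ↦ mem_unitsSup.2 ⟨u, rfl⟩
    exact ⟨by rw [h]; exact one_dvd _, fun _ ↦ h⟩
  | succ n ih =>
    let g := (incl F (Nat.le_succ n)).toRingHom
    have hcomp : (incl F (Nat.zero_le (n + 1))).toRingHom =
        g.comp (incl F (Nat.zero_le n)).toRingHom := rfl
    have hmul := index_unitsSup_comp (incl F (Nat.zero_le n)).toRingHom g A
    have ih' := ih (A.comap g) hA
    have hstep := hF.index_unitsSup_succ hm hmk hζ (hdeg n) (hx (n + 1)) A hA
    rw [hcomp, hmul]
    refine ⟨by rw [pow_succ]; exact mul_dvd_mul ih'.1 hstep.1, fun hunit ↦ ?_⟩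
    rw [ih'.2 fun i h ↦ ?_, hstep.2 (hunit n le_rfl)]
    have h1 : A.valuation (g (incl F h (x (i + 1)))) = A.valuation (g 1) := by
      rw [map_one, map_one]
      exact hunit i (h.trans (Nat.le_succ n))
    rw [(valuation_comap_eq_iff g A _ _).2 h1, map_one]

end Tower

/-! ### Values of functions at places -/

section Values

variable {k E L : Type*} [Field k] [Field E] [Algebra k E] [Field L] [Algebra k L]

/-- `ψ : 𝒪 → L` induces a `k`-embedding into `L` of the residue field of the valuation ring `𝒪`: it is
the identity on `k` and maps nonzero exactly the units. -/
structure IsResidueHom (A : ValuationSubring E) (ι : k →+* A) (ψ : A →+* L) : Prop where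
  coe (c : k) : (ι c : E) = algebraMap k E c
  map (c : k) : ψ (ι c) = algebraMap k L c
  isLocalHom : IsLocalHom ψ

namespace IsResidueHom

variable {A : ValuationSubring E} {ι : k →+* A} {ψ : A →+* L}

theorem coe_eval₂ (h : IsResidueHom A ι ψ) (z : A) (p : k[X]) :
    ((p.eval₂ ι z : A) : E) = aeval (z : E) p := by
  have := hom_eval₂ p ι A.subtype z
  rw [show A.subtype.comp ι = algebraMap k E from RingHom.ext h.coe] at this
  exact this

theorem map_eval₂ (h : IsResidueHom A ι ψ) (z : A) (p : k[X]) :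
    ψ (p.eval₂ ι z) = (p.map (algebraMap k L)).eval (ψ z) := by
  rw [hom_eval₂, eval_map, show ψ.comp ι = algebraMap k L from RingHom.ext h.map]

theorem valuation_eq_one (h : IsResidueHom A ι ψ) {z : A} (hz : ψ z ≠ 0) :
    A.valuation (z : E) = 1 := by
  have := h.isLocalHom
  exact (A.valuation_eq_one_iff z).1 (isUnit_of_map_unit ψ z hz.isUnit)

/-- For coprime `p, q`, the fraction `p(t)/q(t)` is regular exactly if `q` does not vanish at the
value of `t`. -/
theorem div_mem_iff (h : IsResidueHom A ι ψ) (t : A) {p q : k[X]} (hpq : IsCoprime p q)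
    (hq : aeval (t : E) q ≠ 0) :
    aeval (t : E) p / aeval (t : E) q ∈ A ↔ (q.map (algebraMap k L)).eval (ψ t) ≠ 0 := by
  constructor
  · intro hmem h0
    have hp : ψ (p.eval₂ ι t) = 0 := by
      have : p.eval₂ ι t = ⟨_, hmem⟩ * q.eval₂ ι t := by
        refine Subtype.ext ?_
        change _ = aeval (t : E) p / aeval (t : E) q * ((q.eval₂ ι t : A) : E)
        rw [h.coe_eval₂, h.coe_eval₂, div_mul_cancel₀ _ hq]
      rw [this, map_mul, h.map_eval₂, h0, mul_zero]
    rw [h.map_eval₂] at hp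
    obtain ⟨a, b, hab⟩ := hpq.map (mapRingHom (algebraMap k L))
    have := congrArg (eval (ψ t)) hab
    simp only [coe_mapRingHom, eval_add, eval_mul, hp, h0, mul_zero, add_zero, eval_one] at this
    exact zero_ne_one this
  · intro h0
    rw [← h.map_eval₂] at h0
    rw [← A.valuation_le_one_iff, map_div₀, ← h.coe_eval₂, ← h.coe_eval₂, h.valuation_eq_one h0,
      div_one]
    exact A.valuation_le_one _

/-- A place of a rational function field `k(t)` is determined by the value of `t`. -/
theorem eq_of_map_eq (h : IsResidueHom A ι ψ) {B : ValuationSubring E} {ι' : k →+* B}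
    {ψ' : B →+* L} (h' : IsResidueHom B ι' ψ') {t : E} (ht : k⟮t⟯ = ⊤) (hA : t ∈ A) (hB : t ∈ B)
    (heq : ψ ⟨t, hA⟩ = ψ' ⟨t, hB⟩) : A = B := by
  ext z
  by_cases hz : z = 0
  · simp [hz]
  obtain ⟨p, q, hpq⟩ := (mem_adjoin_simple_iff k z).1 (ht ▸ mem_top : z ∈ k⟮t⟯)
  have hq0 : aeval t q ≠ 0 := by
    intro h0
    rw [h0, div_zero] at hpq
    exact hz hpq
  have hq : q ≠ 0 := by
    rintro rfl
    simp at hq0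
  obtain ⟨p', q', g, hcop, rfl, rfl⟩ := UniqueFactorizationMonoid.exists_reduced_factors' p q hq
  rw [map_mul] at hq0
  rw [hpq, map_mul, map_mul, mul_div_mul_left _ _ (left_ne_zero_of_mul hq0)]
  have hA' := h.div_mem_iff ⟨t, hA⟩ hcop.isCoprime (right_ne_zero_of_mul hq0)
  have hB' := h'.div_mem_iff ⟨t, hB⟩ hcop.isCoprime (right_ne_zero_of_mul hq0)
  rw [← heq] at hB'
  exact hA'.trans hB'.symm

end IsResidueHom

/-- The residue field of a place of a function field of one variable is algebraic over the constant
field, and so embeds into its algebraic closure. -/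
theorem exists_isResidueHom [IsAlgClosed L] {t : E} [Algebra.IsAlgebraic k⟮t⟯ E]
    (P : Place k E) : ∃ (ι : k →+* P.ring) (ψ : P.ring →+* L), IsResidueHom P.ring ι ψ := by
  let ι : k →+* P.ring := (algebraMap k E).codRestrict P.ring.toSubring P.algebraMap_mem
  let κ := IsLocalRing.ResidueField P.ring
  let res : P.ring →+* κ := IsLocalRing.residue P.ring
  let : Algebra k κ := (res.comp ι).toAlgebra
  obtain ⟨w, hw⟩ : ∃ w : E, w ∉ P.ring := by
    by_contra! h
    exact P.ne_top (eq_top_iff.2 fun z _ ↦ h z)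
  have hw0 : w ≠ 0 := fun h ↦ hw (h ▸ P.ring.zero_mem)
  have hinv : w⁻¹ ∈ P.ring := (P.ring.mem_or_inv_mem w).resolve_left hw
  have hvlt : P.ring.valuation w⁻¹ < 1 := by
    rw [← ValuationSubring.mem_nonunits_iff, ValuationSubring.inv_mem_nonunits_iff]
    exact Or.inr hw
  have hres : res ⟨w⁻¹, hinv⟩ = 0 := by
    rw [IsLocalRing.residue_eq_zero_iff, P.ring.valuation_lt_one_iff]
    exact hvlt
  have htr : Transcendental k w⁻¹ :=
    transcendental_of_valuation_lt_one P.ring P.algebraMap_mem (inv_ne_zero hw0) hvlt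
  have halg : Algebra.IsAlgebraic k κ := by
    refine ⟨fun z ↦ ?_⟩
    obtain ⟨z, rfl⟩ := IsLocalRing.residue_surjective z
    obtain ⟨p, hp, hpz⟩ := exists_isPrimitive_eval₂_eq_zero (t := t) htr (z : E)
    let θ : k[X] →+* P.ring := eval₂RingHom ι ⟨w⁻¹, hinv⟩
    have hθ : P.ring.subtype.comp θ = (aeval w⁻¹ : k[X] →ₐ[k] E).toRingHom := by
      refine Polynomial.ringHom_ext (fun c ↦ ?_) ?_
      · change ((eval₂ ι _ (C c) : P.ring) : E) = aeval _ (C c)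
        rw [eval₂_C, aeval_C]
        rfl
      · change ((eval₂ ι _ X : P.ring) : E) = aeval _ X
        rw [eval₂_X, aeval_X]
    have hθ' : res.comp θ = (algebraMap k κ).comp (evalRingHom 0) := by
      refine Polynomial.ringHom_ext (fun c ↦ ?_) ?_
      · change res (eval₂ ι _ (C c)) = algebraMap k κ (eval 0 (C c))
        rw [eval₂_C, eval_C]
        rfl
      · change res (eval₂ ι _ X) = algebraMap k κ (eval 0 X)
        rw [eval₂_X, eval_X, map_zero, hres]
    have hz0 : p.eval₂ θ z = 0 := by
      refine Subtype.ext ?_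
      have := hom_eval₂ p θ P.ring.subtype z
      rw [hθ] at this
      exact this.trans hpz
    -- reducing the equation modulo the place puts `0` for `w⁻¹`; it survives as `p` is primitive
    refine ⟨p.map (evalRingHom 0), fun h0 ↦ ?_, ?_⟩
    · refine not_isUnit_X (hp X (C_dvd_iff_dvd_coeff _ _ |>.2 fun i ↦ ?_))
      rw [X_dvd_iff, coeff_zero_eq_eval_zero]
      simpa using congrArg (fun q ↦ q.coeff i) h0
    · have := congrArg res hz0
      rw [hom_eval₂, hθ', map_zero] at this
      rw [aeval_def, eval₂_map]
      exact this
  let φ : κ →ₐ[k] L := IsAlgClosed.lift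
  refine ⟨ι, φ.toRingHom.comp res, fun c ↦ rfl, fun c ↦ φ.commutes c, ?_⟩
  have : IsLocalHom res := inferInstanceAs (IsLocalHom (IsLocalRing.residue P.ring))
  exact RingHom.isLocalHom_comp _ _

theorem Place.HasValue.exists_isResidueHom {P : Place k E} {z : E} {γ : L} (h : P.HasValue z γ) :
    ∃ (ι : k →+* P.ring) (ψ : P.ring →+* L) (hz : z ∈ P.ring),
      IsResidueHom P.ring ι ψ ∧ ψ ⟨z, hz⟩ = γ := by
  obtain ⟨hz, φ, hφ, hγ⟩ := h
  refine ⟨(algebraMap k E).codRestrict P.ring.toSubring P.algebraMap_mem,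
    φ.comp (IsLocalRing.residue P.ring), hz, ⟨fun c ↦ rfl, hφ, ?_⟩, hγ⟩
  exact RingHom.isLocalHom_comp _ _

/-- `z(P) = ψ(z)`, if `ψ` is given on a valuation ring that lies over that of `P`. -/
theorem IsResidueHom.hasValue {F : Type*} [Field F] [Algebra k F] {f : F →ₐ[k] E}
    {Q : Place k E} {P : Place k F} (hQP : Q.LiesOver f P) {ι : k →+* Q.ring} {ψ : Q.ring →+* L}
    (h : IsResidueHom Q.ring ι ψ) {z : F} (hz : f z ∈ Q.ring) : P.HasValue z (ψ ⟨f z, hz⟩) := by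
  have hmem : ∀ a : F, a ∈ P.ring ↔ f a ∈ Q.ring := fun a ↦ by
    rw [← hQP]
    exact ValuationSubring.mem_comap
  let g : P.ring →+* Q.ring :=
    ((f : F →+* E).comp P.ring.subtype).codRestrict Q.ring.toSubring fun a ↦ (hmem a).1 a.2
  have hg : IsLocalHom g := by
    refine ⟨fun a ha ↦ ?_⟩
    have ha0 : (a : F) ≠ 0 := by
      intro h0
      refine ha.ne_zero (Subtype.ext ?_)
      change f (a : F) = 0
      rw [h0, map_zero]
    obtain ⟨b, hb⟩ := isUnit_iff_exists_inv.1 ha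
    have hb' : f (a : F) * (b : E) = 1 := congrArg Subtype.val hb
    have hinv : (a : F)⁻¹ ∈ P.ring := by
      rw [hmem, map_inv₀, ← eq_inv_of_mul_eq_one_right hb']
      exact b.2
    exact isUnit_iff_exists_inv.2 ⟨⟨_, hinv⟩, Subtype.ext (mul_inv_cancel₀ ha0)⟩
  have hψ := h.isLocalHom
  have : IsLocalHom (ψ.comp g) := RingHom.isLocalHom_comp _ _
  refine ⟨(hmem z).2 hz, IsLocalRing.ResidueField.lift (ψ.comp g), fun c ↦ ?_, ?_⟩
  · rw [IsLocalRing.ResidueField.lift_residue_apply, ← h.map]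
    refine congrArg ψ (Subtype.ext ?_)
    rw [h.coe]
    exact f.commutes c
  · rw [IsLocalRing.ResidueField.lift_residue_apply]
    rfl

end Values

/-! ### The ramification locus -/

section Locus

variable {k E L : Type*} [Field k] [Field E] [Algebra k E] [Field L] [Algebra k L]
  {m : ℕ} {b₁ b₂ : k[X]}

/-- A value `ψ(z)` outside `S₀` is followed, under `z' ^ m = b₁(z)/b₂(z)`, by a nonzero finite value
outside `S₀`. -/
theorem IsResidueHom.succ_notMem {A : ValuationSubring E} {ι : k →+* A} {ψ : A →+* L}
    (h : IsResidueHom A ι ψ) (hm : m ≠ 0) {S₀ : Set L}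
    (h₁ : zeroSet (b₁.map (algebraMap k L)) ⊆ S₀) (h₂ : zeroSet (b₂.map (algebraMap k L)) ⊆ S₀)
    (h₃ : ∀ γ ∈ S₀, zeroSet (sigma m b₁ b₂ γ) ⊆ S₀) {z z' : E} (hz : z ∈ A)
    (hzS : ψ ⟨z, hz⟩ ∉ S₀) (hzz' : z' ^ m = aeval z b₁ / aeval z b₂) :
    A.valuation z' = 1 ∧ ∃ hz' : z' ∈ A, ψ ⟨z', hz'⟩ ∉ S₀ := by
  have hb₁ : (b₁.map (algebraMap k L)).eval (ψ ⟨z, hz⟩) ≠ 0 := fun h0 ↦ hzS (h₁ h0)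
  have hb₂ : (b₂.map (algebraMap k L)).eval (ψ ⟨z, hz⟩) ≠ 0 := fun h0 ↦ hzS (h₂ h0)
  have hv₁ := h.valuation_eq_one (z := b₁.eval₂ ι ⟨z, hz⟩) (by rwa [h.map_eval₂])
  have hv₂ := h.valuation_eq_one (z := b₂.eval₂ ι ⟨z, hz⟩) (by rwa [h.map_eval₂])
  rw [h.coe_eval₂] at hv₁ hv₂
  have hv : A.valuation z' = 1 := by
    rw [← pow_eq_one_iff_of_nonneg zero_le hm, ← map_pow, hzz', map_div₀, hv₁, hv₂, div_one]
  have hz' : z' ∈ A := (A.valuation_le_one_iff _).1 hv.le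
  refine ⟨hv, hz', fun hmem ↦ hzS (h₃ _ hmem ?_)⟩
  have hb₂0 : aeval z b₂ ≠ 0 := by
    rw [← Valuation.ne_zero_iff A.valuation, hv₂]
    exact one_ne_zero
  have heq : b₂.eval₂ ι ⟨z, hz⟩ * ⟨z', hz'⟩ ^ m = b₁.eval₂ ι ⟨z, hz⟩ := by
    refine Subtype.ext ?_
    change ((b₂.eval₂ ι ⟨z, hz⟩ : A) : E) * z' ^ m = _
    rw [h.coe_eval₂, h.coe_eval₂, hzz', mul_div_cancel₀ _ hb₂0]
  have hψ := congrArg ψ heq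
  rw [map_mul, map_pow, h.map_eval₂, h.map_eval₂] at hψ
  change (sigma m b₁ b₂ _).eval _ = 0
  rw [sigma, eval_sub, eval_mul, eval_C, hψ, sub_self]

variable {Ω : Type*} [Field Ω] [Algebra k Ω] {F : ℕ →o IntermediateField k Ω} {x : (i : ℕ) → F i}

theorem IsKummerRecursive.valuation_incl_eq_one (hF : IsKummerRecursive m b₁ b₂ F x) (hm : m ≠ 0)
    {S₀ : Set L} (h₁ : zeroSet (b₁.map (algebraMap k L)) ⊆ S₀)
    (h₂ : zeroSet (b₂.map (algebraMap k L)) ⊆ S₀)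
    (h₃ : ∀ γ ∈ S₀, zeroSet (sigma m b₁ b₂ γ) ⊆ S₀) {n : ℕ} {A : ValuationSubring (F n)}
    {ι : k →+* A} {ψ : A →+* L} (h : IsResidueHom A ι ψ)
    (h0 : incl F (Nat.zero_le n) (x 0) ∈ A) (h0S : ψ ⟨_, h0⟩ ∉ S₀) (i : ℕ) (hi : i + 1 ≤ n) :
    A.valuation (incl F hi (x (i + 1))) = 1 := by
  have hstep : ∀ (i : ℕ) (hi : i + 1 ≤ n) (hz : incl F (Nat.le_of_succ_le hi) (x i) ∈ A),
      ψ ⟨_, hz⟩ ∉ S₀ → A.valuation (incl F hi (x (i + 1))) = 1 ∧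
        ∃ hz' : incl F hi (x (i + 1)) ∈ A, ψ ⟨_, hz'⟩ ∉ S₀ := by
    intro i hi hz hzS
    refine h.succ_notMem hm h₁ h₂ h₃ hz hzS (Subtype.ext ?_)
    have hcoe : ∀ p : k[X], ((aeval (incl F (Nat.le_of_succ_le hi) (x i)) p : F n) : Ω) =
        aeval (x i : Ω) p := fun p ↦
      (aeval_algHom_apply (F n).val (incl F (Nat.le_of_succ_le hi) (x i)) p).symm
    change (x (i + 1) : Ω) ^ m = ((aeval _ b₁ : F n) : Ω) / ((aeval _ b₂ : F n) : Ω)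
    rw [hcoe, hcoe, hF.equation]
  have hmem : ∀ (i : ℕ) (hi : i ≤ n), ∃ hz : incl F hi (x i) ∈ A, ψ ⟨_, hz⟩ ∉ S₀ := by
    intro i
    induction i with
    | zero => exact fun _ ↦ ⟨h0, h0S⟩
    | succ i ih =>
      intro hi
      obtain ⟨hz, hzS⟩ := ih (Nat.le_of_succ_le hi)
      exact (hstep i hi hz hzS).2
  obtain ⟨hz, hzS⟩ := hmem i (Nat.le_of_succ_le hi)
  exact (hstep i hi hz hzS).1

/-- There is at most one pole of a generator of a rational function field. -/
theorem subsingleton_isPole [IsAlgClosed L] {t : E} (ht : k⟮t⟯ = ⊤) :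
    {P : Place k E | P.IsPole t}.Subsingleton := by
  have : Algebra.IsAlgebraic k⟮t⟯ E := by
    refine ⟨fun z ↦ ?_⟩
    exact isAlgebraic_algebraMap (⟨z, ht ▸ mem_top⟩ : k⟮t⟯)
  have hinv : k⟮t⁻¹⟯ = ⊤ := by
    rw [← ht]
    refine le_antisymm (adjoin_simple_le_iff.2 (inv_mem (mem_adjoin_simple_self k t)))
      (adjoin_simple_le_iff.2 ?_)
    simpa using inv_mem (mem_adjoin_simple_self k t⁻¹)
  have hpole : ∀ P : Place k E, P.IsPole t → ∃ (ι : k →+* P.ring) (ψ : P.ring →+* L)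
      (hP : t⁻¹ ∈ P.ring), IsResidueHom P.ring ι ψ ∧ ψ ⟨t⁻¹, hP⟩ = 0 := by
    intro P hP
    obtain ⟨ι, ψ, h⟩ := exists_isResidueHom (L := L) (t := t) P
    refine ⟨ι, ψ, (P.ring.mem_or_inv_mem t).resolve_left hP, h, ?_⟩
    by_contra h0
    refine hP ?_
    have := h.valuation_eq_one h0
    rw [map_inv₀, inv_eq_one] at this
    exact (P.ring.valuation_le_one_iff _).1 this.le
  intro P hP P' hP'
  obtain ⟨ι, ψ, hmem, h, h0⟩ := hpole P hP
  obtain ⟨ι', ψ', hmem', h', h0'⟩ := hpole P' hP'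
  exact Place.ext (h.eq_of_map_eq h' hinv hmem hmem' (h0.trans h0'.symm))

theorem subsingleton_hasValue {t : E} (ht : k⟮t⟯ = ⊤) (γ : L) :
    {P : Place k E | P.HasValue t γ}.Subsingleton := by
  intro P hP P' hP'
  obtain ⟨ι, ψ, hmem, h, h0⟩ := hP.exists_isResidueHom
  obtain ⟨ι', ψ', hmem', h', h0'⟩ := hP'.exists_isResidueHom
  exact Place.ext (h.eq_of_map_eq h' ht hmem hmem' (h0.trans h0'.symm))

theorem IsKummerRecursive.adjoin_zero_eq_top (hF : IsKummerRecursive m b₁ b₂ F x) :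
    k⟮x 0⟯ = (⊤ : IntermediateField k (F 0)) := by
  refine map_injective (F 0).val ?_
  rw [adjoin_map, Set.image_singleton, ← AlgHom.fieldRange_eq_map, fieldRange_val]
  exact hF.zero.symm

end Locus

theorem ramificationIdx_eq_index {k F E : Type*} [Field k] [Field F] [Field E] [Algebra k F]
    [Algebra k E] (f : F →ₐ[k] E) (Q : Place k E) :
    Q.ramificationIdx f = (unitsSup f.toRingHom Q.ring).index :=
  rfl

end FunctionFieldSeq

open FunctionFieldSeq

theorem proposition3p2
    {k : Type*} [Field k] [Finite k] (m : ℕ) (hm : 2 ≤ m) (hq : Nat.card k ≡ 1 [MOD m])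
    (r : ℤ) (b₁ b₂ : Polynomial k) (hcop : IsCoprime b₁ b₂)
    (hb₁ : b₁.natDegree = m) (hb₂ : (b₂.natDegree : ℤ) = m - r) (hr : Int.gcd m r = 1)
    {Ω : Type*} [Field Ω] [Algebra k Ω] (F : ℕ →o IntermediateField k Ω) (x : (i : ℕ) → F i)
    (hF : FunctionFieldSeq.IsKummerRecursive m b₁ b₂ F x)
    (L : Type*) [Field L] [Algebra k L] [IsAlgClosure k L] :
    FunctionFieldSeq.IsAdmissible F ∧ FunctionFieldSeq.IsTame F ∧
      ∀ S₀ : Set L, S₀.Finite →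
        FunctionFieldSeq.zeroSet (b₁.map (algebraMap k L)) ⊆ S₀ →
        FunctionFieldSeq.zeroSet (b₂.map (algebraMap k L)) ⊆ S₀ →
        (∀ γ ∈ S₀, FunctionFieldSeq.zeroSet (FunctionFieldSeq.sigma m b₁ b₂ γ) ⊆ S₀) →
        (FunctionFieldSeq.ramLocus F).Finite ∧
          ∀ P ∈ FunctionFieldSeq.ramLocus F,
            P.IsPole (x 0) ∨ ∃ γ ∈ S₀, P.HasValue (x 0) γ := by
  have hmk : (m : k) ≠ 0 := natCast_ne_zero_of_card_modEq hq
  obtain ⟨ζ, hζ⟩ := exists_isPrimitiveRoot_of_card_modEq hq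
  have hx : ∀ n, (x n : Ω) ≠ 0 := fun n ↦ ne_zero_of_transcendental
    (hF.transcendental_coe hcop (by omega) (ne_zero_of_natDegree_eq_sub hm hb₂ hr) n)
  have hindex := hF.index_unitsSup_zero (by omega) hmk hζ
    (hF.relfinrank_succ hm hcop hb₁ hb₂ hr) hx
  refine ⟨hF.isAdmissible hm hmk hcop hb₁ hb₂ hr, ?_, ?_⟩
  · intro n P Q _
    rw [ramificationIdx_eq_index]
    refine Nat.Coprime.coprime_dvd_left (hindex n Q.ring Q.algebraMap_mem).1
      (Nat.Coprime.pow_left n (Nat.Coprime.symm ?_))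
    have hp : (ringChar k).Prime := CharP.prime_ringChar k
    rw [hp.coprime_iff_not_dvd, ← ringChar.spec]
    exact hmk
  · intro S₀ hS₀ h₁ h₂ h₃
    have hL : IsAlgClosed L := IsAlgClosure.isAlgClosed k
    have hlocus : ∀ P ∈ ramLocus F, P.IsPole (x 0) ∨ ∃ γ ∈ S₀, P.HasValue (x 0) γ := by
      rintro P ⟨n, Q, hQP, hram⟩
      by_cases hP : P.IsPole (x 0)
      · exact Or.inl hP
      right
      have h0 : incl F (Nat.zero_le n) (x 0) ∈ Q.ring := by
        have : x 0 ∈ P.ring := not_not.1 hP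
        rw [← hQP] at this
        exact ValuationSubring.mem_comap.1 this
      have hfin := hF.finiteDimensional_adjoin_zero (by omega) n
      obtain ⟨ι, ψ, h⟩ := exists_isResidueHom (L := L) (t := incl F (Nat.zero_le n) (x 0)) Q
      refine ⟨ψ ⟨_, h0⟩, ?_, h.hasValue hQP h0⟩
      -- a value outside `S₀` would make `x 1, …, x n` units at `Q`, hence `Q` unramified
      by_contra h0S
      rw [ramificationIdx_eq_index, (hindex n Q.ring Q.algebraMap_mem).2
        (hF.valuation_incl_eq_one (by omega) h₁ h₂ h₃ h h0 h0S)] at hram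
      exact lt_irrefl _ hram
    refine ⟨Set.Finite.subset (s := {P | P.IsPole (x 0)} ∪ ⋃ γ ∈ S₀, {P | P.HasValue (x 0) γ})
      ?_ ?_, hlocus⟩
    · have htop := hF.adjoin_zero_eq_top
      exact (subsingleton_isPole (L := L) htop).finite.union
        (hS₀.biUnion fun γ _ ↦ (subsingleton_hasValue htop γ).finite)
    · intro P hP
      simpa using hlocus P hP
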